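/- Let $P,Q$ be real polynomials in one variable. There is $N\in\mathbb N$, depending only on $P$ and $Q$, such that the following holds for all $0<\beta<\alpha\le 1$. Functions on $\mathbb T^2=\mathbb R^2/(2\pi\mathbb Z)^2$ are identified with functions on $\mathbb R^2$ that are $2\pi$-periodic in each variable; $\|f\|_{L^1(\mathbb T^2)}=\int_{-\pi}^{\pi}\int_{-\pi}^{\pi}|f|\,dx\,dy$; $C_b(\mathbb R^2)$ is the Banach space of bounded continuous functions with the sup norm; $a^+=\max(0,a)$, $a^-=\max(0,-a)$. Let $\phi\in C_c^\infty(\mathbb R^2)$ with $\int\phi=1$, and $\phi_{h}(x,y)=h^{-2}\phi(x/h,y/h)$. For $0<\epsilon<1$ and $t\ge0$ let $u^\epsilon(\cdot,t),v^\epsilon(\cdot,t)$ be continuous functions on $\mathbb T^2$ (the velocity components, for instance approximate solutions of scalar conservation laws $\partial_tu+\partial_xf_1(u)+\partial_yf_2(u)=0$, $\partial_tv+\partial_xg_1(v)+\partial_yg_2(v)=0$), continuous in $t\in[0,\infty)$ for the sup norm, bounded uniformly in $(\epsilon,x,y,t)$, having first partial derivatives in $x$ and $y$ at every point, and such that for every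 $\delta>0$ there is a constant $c$ with $$|\partial_xu^\epsilon|,\ |\partial_yu^\epsilon|,\ |\partial_xv^\epsilon|,\ |\partial_yv^\epsilon|\ \le\ \frac{c}{\epsilon^{\beta}}\qquad\text{on }\mathbb T^2\times[0,\delta],\ 0<\epsilon<1 .$$ Let $\rho_0^\epsilon,w_0^\epsilon$ be continuous functions on $\mathbb T^2$ that are bounded in $L^1(\mathbb T^2)$ uniformly in $\epsilon\in(0,1)$. Put $$(A^\epsilon_tX)(x,y)=\tfrac1\epsilon\big[(Xu^{\epsilon+})(x-\epsilon,y)-(X|u^\epsilon|)(x,y)+(Xu^{\epsilon-})(x+\epsilon,y)+(Xv^{\epsilon+})(x,y-\epsilon)-(X|v^\epsilon|)(x,y)+(Xv^{\epsilon-})(x,y+\epsilon)\big],$$ the velocities being taken at time $t$. Then: 1. For each $\epsilon\in(0,1)$ the linear ODE $\frac{d}{dt}X^\epsilon=A^\epsilon_tX^\epsilon$, $X^\epsilon(\cdot,0)=\rho_0^\epsilon$, in $C_b(\mathbb R^2)$ has a unique solution on $[0,\infty)$. With $\rho^\epsilon(\cdot,t)=X^\epsilon(\cdot,t)*\phi_{\epsilon^\alpha}$,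 which is $C^\infty$ in $(x,y)$, the ODE $$\tfrac{d}{dt}w^\epsilon=A^\epsilon_tw^\epsilon-P'(\rho^\epsilon)\,\partial_x\rho^\epsilon-Q'(\rho^\epsilon)\,\partial_y\rho^\epsilon,\qquad w^\epsilon(\cdot,0)=w_0^\epsilon,$$ in $C_b(\mathbb R^2)$ also has a unique solution on $[0,\infty)$. Both solutions are $2\pi$-periodic in $x$ and $y$. 2. There is a constant $C$ with $\|X^\epsilon(\cdot,t)\|_{L^1(\mathbb T^2)}\le\|\rho_0^\epsilon\|_{L^1(\mathbb T^2)}\le C$ for all $t\ge0$, $0<\epsilon<1$. 3. There is a constant $M$ with $|\rho^\epsilon|\le M\epsilon^{-2\alpha}$ and $|\partial_x\rho^\epsilon|,|\partial_y\rho^\epsilon|\le M\epsilon^{-3\alpha}$ on $\mathbb T^2\times[0,\infty)$ for all $0<\epsilon<1$. 4. There is a constant $C>0$ with $\|w^\epsilon(\cdot,t)\|_{L^1(\mathbb T^2)}\le C(1+t)\,\epsilon^{-N\alpha}$ for all $t\ge0$, $0<\epsilon<1$. In particular this $L^1$ norm is $O(\epsilon^{-N\alpha})$ uniformly for $t$ in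 bounded intervals. 5. $(u^\epsilon,v^\epsilon,\rho^\epsilon)$ is a weak asymptotic method for $\partial_t\rho+\partial_x(\rho u)+\partial_y(\rho v)=0$: for all $\psi\in C_c^\infty(\mathbb R^2)$, $$\int_{\mathbb R^2}\big[\partial_t\rho^\epsilon\,\psi-u^\epsilon\rho^\epsilon\,\partial_x\psi-v^\epsilon\rho^\epsilon\,\partial_y\psi\big]dx\,dy\to0\qquad(\epsilon\to0^+),$$ uniformly for $t$ in bounded subsets of $[0,\infty)$. 6. If $N\alpha<1$, then $(u^\epsilon,v^\epsilon,\rho^\epsilon,w^\epsilon)$ is a weak asymptotic method for $\partial_tw+\partial_x(uw)+\partial_y(vw)+\partial_xP(\rho)+\partial_yQ(\rho)=0$: for all $\psi\in C_c^\infty(\mathbb R^2)$, $$\int_{\mathbb R^2}\big[\partial_tw^\epsilon\,\psi-(u^\epsilon w^\epsilon+P(\rho^\epsilon))\,\partial_x\psi-(v^\epsilon w^\epsilon+Q(\rho^\epsilon))\,\partial_y\psi\big]dx\,dy\to0\qquad(\epsilon\to0^+),$$ uniformly for $t$ in bounded subsets of $[0,\infty)$. 7. If $\rho_0^\epsilon\to\rho_0$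 in $L^1(\mathbb T^2)$ as $\epsilon\to0^+$, then $\rho^\epsilon(\cdot,0)\to\rho_0$ in the sense of distributions on $\mathbb R^2$; if $w_0^\epsilon\to w_0$ in $L^1(\mathbb T^2)$, then $w^\epsilon(\cdot,0)\to w_0$ in the sense of distributions. -/

import Mathlib

open MeasureTheory Filter Topology Set
open scoped ContDiff BoundedContinuousFunction

noncomputable section

/-- A function on the plane is `2π`-periodic in both variables, i.e. it is a function on the torus. -/
def IsTorusPeriodic (f : ℝ × ℝ → ℝ) : Prop :=
  ∀ x y : ℝ, f (x + 2 * Real.pi, y) = f (x, y) ∧ f (x, y + 2 * Real.pi) = f (x, y)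

/-- The `L¹` norm over one period: `∫_{-π}^{π} ∫_{-π}^{π} |f(x,y)| dx dy`. -/
def torusL1 (f : ℝ × ℝ → ℝ) : ℝ :=
  ∫ p in Icc (-Real.pi) Real.pi ×ˢ Icc (-Real.pi) Real.pi, |f p|

/-- Partial derivative in the first variable. -/
def partialX (f : ℝ × ℝ → ℝ) (p : ℝ × ℝ) : ℝ := deriv (fun s : ℝ => f (s, p.2)) p.1

/-- Partial derivative in the second variable. -/
def partialY (f : ℝ × ℝ → ℝ) (p : ℝ × ℝ) : ℝ := deriv (fun s : ℝ => f (p.1, s)) p.2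

/-- The family of velocity components `u ε t (x, y)`, `0 < ε < 1`, `t ≥ 0`: periodic, continuous in
time with values in the bounded continuous functions, uniformly bounded, and with first order
partial derivatives in space that are `O(ε^{-β})` uniformly on `[0, δ] × 𝕋²` for every `δ`. -/
structure IsVelocityFamily (β : ℝ) (u : ℝ → ℝ → (ℝ × ℝ →ᵇ ℝ)) : Prop where
  periodic : ∀ ε ∈ Ioo (0 : ℝ) 1, ∀ t : ℝ, 0 ≤ t → IsTorusPeriodic (u ε t)
  continuous_time : ∀ ε ∈ Ioo (0 : ℝ) 1, ContinuousOn (u ε) (Ici 0)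
  bounded : ∃ M : ℝ, ∀ ε ∈ Ioo (0 : ℝ) 1, ∀ t : ℝ, 0 ≤ t → ∀ p : ℝ × ℝ, |u ε t p| ≤ M
  differentiable : ∀ ε ∈ Ioo (0 : ℝ) 1, ∀ t : ℝ, 0 ≤ t → ∀ p : ℝ × ℝ,
    DifferentiableAt ℝ (fun s : ℝ => u ε t (s, p.2)) p.1 ∧
      DifferentiableAt ℝ (fun s : ℝ => u ε t (p.1, s)) p.2
  gradient_bound : ∀ δ : ℝ, 0 < δ → ∃ c : ℝ, ∀ ε ∈ Ioo (0 : ℝ) 1, ∀ t ∈ Icc 0 δ, ∀ p : ℝ × ℝ,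
    |partialX (u ε t) p| ≤ c / ε ^ β ∧ |partialY (u ε t) p| ≤ c / ε ^ β

/-- Regularized initial data: continuous periodic functions bounded in `L¹(𝕋²)` uniformly in `ε`. -/
structure IsInitialFamily (f : ℝ → (ℝ × ℝ →ᵇ ℝ)) : Prop where
  periodic : ∀ ε ∈ Ioo (0 : ℝ) 1, IsTorusPeriodic (f ε)
  bounded : ∃ C : ℝ, ∀ ε ∈ Ioo (0 : ℝ) 1, torusL1 (f ε) ≤ C

/-- The upwind discretization, with step `ε` and in both axis directions, of
`-∂ₓ(X u) - ∂_y(X v)`. -/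
def upwind (ε : ℝ) (u v X : ℝ × ℝ → ℝ) (p : ℝ × ℝ) : ℝ :=
  1 / ε *
    (X (p.1 - ε, p.2) * max 0 (u (p.1 - ε, p.2)) - X p * |u p|
        + X (p.1 + ε, p.2) * max 0 (-u (p.1 + ε, p.2))
      + X (p.1, p.2 - ε) * max 0 (v (p.1, p.2 - ε)) - X p * |v p|
        + X (p.1, p.2 + ε) * max 0 (-v (p.1, p.2 + ε)))

/-- `X : [0, ∞) → C_b(ℝ²)` solves the linear ODE `X' = upwind X + S`, `X(0) = X₀` in the Banach space
of bounded continuous functions with the sup norm (the derivative at `t = 0` is one-sided). Values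
of `X` at negative times are irrelevant. -/
def IsUpwindSolution (ε : ℝ) (u v : ℝ → (ℝ × ℝ →ᵇ ℝ)) (S : ℝ → ℝ × ℝ → ℝ) (X₀ : ℝ × ℝ →ᵇ ℝ)
    (X : ℝ → (ℝ × ℝ →ᵇ ℝ)) : Prop :=
  X 0 = X₀ ∧
    ∀ t : ℝ, 0 ≤ t → ∃ D : ℝ × ℝ →ᵇ ℝ,
      (∀ p : ℝ × ℝ, D p = upwind ε (u t) (v t) (X t) p + S t p) ∧
        HasDerivWithinAt X D (Ici 0) t

/-- The upwind ODE has `X` as a solution on `[0, ∞)`, and as its only one. -/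
def IsUniqueUpwindSolution (ε : ℝ) (u v : ℝ → (ℝ × ℝ →ᵇ ℝ)) (S : ℝ → ℝ × ℝ → ℝ)
    (X₀ : ℝ × ℝ →ᵇ ℝ) (X : ℝ → (ℝ × ℝ →ᵇ ℝ)) : Prop :=
  IsUpwindSolution ε u v S X₀ X ∧
    ∀ Y : ℝ → (ℝ × ℝ →ᵇ ℝ), IsUpwindSolution ε u v S X₀ Y → ∀ t : ℝ, 0 ≤ t → Y t = X t

/-- A smooth compactly supported function on the plane. -/
def IsTestFunction (ψ : ℝ × ℝ → ℝ) : Prop := ContDiff ℝ ∞ ψ ∧ HasCompactSupport ψ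

/-- `φ_h(x, y) = h⁻² φ(x / h, y / h)`. -/
def scaledKernel (φ : ℝ × ℝ → ℝ) (h : ℝ) (p : ℝ × ℝ) : ℝ := 1 / h ^ 2 * φ (p.1 / h, p.2 / h)

/-- `ρ^ε(·, t) = X^ε(·, t) * φ_{ε^α}`. -/
def mollified (φ : ℝ × ℝ → ℝ) (α : ℝ) (X : ℝ → ℝ → (ℝ × ℝ →ᵇ ℝ)) (ε t : ℝ) : ℝ × ℝ → ℝ :=
  convolution (X ε t) (scaledKernel φ (ε ^ α)) (ContinuousLinearMap.mul ℝ ℝ) volume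

/-- `-P'(r) ∂ₓ r - Q'(r) ∂_y r`, with time as a parameter. -/
def pressureSource (P Q : Polynomial ℝ) (r : ℝ → ℝ × ℝ → ℝ) (t : ℝ) (p : ℝ × ℝ) : ℝ :=
  -(P.derivative.eval (r t p) * partialX (r t) p)
    - Q.derivative.eval (r t p) * partialY (r t) p

/-- The integrand of the weak form in space of `∂_t q + ∂ₓ F + ∂_y G`, tested against `ψ`. -/
def weakIntegrand (q F G : ℝ → ℝ × ℝ → ℝ) (ψ : ℝ × ℝ → ℝ) (t : ℝ) (p : ℝ × ℝ) : ℝ :=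
  derivWithin (fun s : ℝ => q s p) (Ici 0) t * ψ p
    - F t p * partialX ψ p - G t p * partialY ψ p

/-- The families `q ε t (x, y)`, `F ε t (x, y)`, `G ε t (x, y)` are a weak asymptotic method for
`∂_t q + ∂ₓ F + ∂_y G = 0`: the left-hand side tends to `0` in the sense of distributions in the
space variables as `ε → 0⁺`, uniformly for `t` in bounded intervals. -/
def IsWeakAsymptoticMethod (q F G : ℝ → ℝ → ℝ × ℝ → ℝ) : Prop :=
  (∀ ε ∈ Ioo (0 : ℝ) 1, ∀ t : ℝ, 0 ≤ t → ∀ p : ℝ × ℝ,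
      DifferentiableWithinAt ℝ (fun s : ℝ => q ε s p) (Ici 0) t) ∧
    ∀ ψ : ℝ × ℝ → ℝ, IsTestFunction ψ →
      (∀ ε ∈ Ioo (0 : ℝ) 1, ∀ t : ℝ, 0 ≤ t →
        Integrable (weakIntegrand (q ε) (F ε) (G ε) ψ t)) ∧
      ∀ δ : ℝ, 0 < δ →
        TendstoUniformlyOn (fun ε t : ℝ => ∫ p, weakIntegrand (q ε) (F ε) (G ε) ψ t p)
          (fun _ => 0) (𝓝[>] 0) (Icc 0 δ)

/-- If the regularized initial data `f ε` tend in `L¹(𝕋²)` to some `f₀ ∈ L¹(𝕋²)`, then the initial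
values `q ε 0` tend to `f₀` in the sense of distributions. -/
def AttainsInitialData (f : ℝ → (ℝ × ℝ →ᵇ ℝ)) (q : ℝ → ℝ → ℝ × ℝ → ℝ) : Prop :=
  ∀ f₀ : ℝ × ℝ → ℝ, IsTorusPeriodic f₀ → LocallyIntegrable f₀ →
    Tendsto (fun ε : ℝ => torusL1 (fun p => f ε p - f₀ p)) (𝓝[>] 0) (𝓝 0) →
      ∀ ψ : ℝ × ℝ → ℝ, IsTestFunction ψ →
        Tendsto (fun ε : ℝ => ∫ p, q ε 0 p * ψ p) (𝓝[>] 0) (𝓝 (∫ p, f₀ p * ψ p))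

end

/-!
For a small time step `h` the explicit Euler step `I + h A_ε` is a positive operator which preserves
the integral over a period. It is therefore an `L¹` contraction, and so is the flow of the ODE.
Mollification at scale `ε^α` turns this `L¹` bound on `X` into the sup bounds `ε^{-2α}` on `ρ` and
`ε^{-3α}` on its gradient; hence the pressure source is `O(ε^{-Nα})`, and the `L¹` norm of `w` is
`O((1 + t) ε^{-Nα})`.

Tested against `ψ`, the upwind operator moves by discrete summation by parts onto `ψ`, whose
difference quotients are derivatives up to `O(ε)`; the consistency error is `O(ε)` times an `L¹`
norm, hence `O(ε^{1-Nα})` for `w`. For `ρ` there is in addition the commutator of multiplication by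
the velocity with mollification, of size `ε^{-β} · ε^α` by the gradient bound. The pressure terms
cancel exactly after integration by parts.
-/

section LipschitzODE

lemma norm_le_of_lipschitzWith {E : Type*} [SeminormedAddCommGroup E] {K : NNReal} {f : E → E}
    (hf : LipschitzWith K f) (x : E) :
    ‖f x‖ ≤ K * ‖x‖ + ‖f 0‖ := by
  have h := (norm_sub_norm_le (f x) (f 0)).trans (hf.norm_sub_le x 0)
  rw [sub_zero] at h
  linarith

variable {E : Type*} [NormedAddCommGroup E] [NormedSpace ℝ E]

lemma integral_const_mul_exp_mul (c : ℝ) {l : ℝ} (hl : l ≠ 0) (t : ℝ) :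
    ∫ s in (0 : ℝ)..t, c * Real.exp (l * s) = c / l * (Real.exp (l * t) - 1) := by
  rw [intervalIntegral.integral_const_mul, intervalIntegral.integral_comp_mul_left _ hl,
    integral_exp, mul_zero, Real.exp_zero, smul_eq_mul]
  ring

lemma norm_exp_neg_smul_integral_le {g : ℝ → E} {c l t : ℝ} (hl : 0 < l) (ht : 0 ≤ t)
    (hg : ∀ s ∈ Ioc 0 t, ‖g s‖ ≤ c * Real.exp (l * s)) (hc : 0 ≤ c) :
    ‖Real.exp (-(l * t)) • ∫ s in (0 : ℝ)..t, g s‖ ≤ c / l := by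
  have hint : ‖∫ s in (0 : ℝ)..t, g s‖ ≤ c / l * (Real.exp (l * t) - 1) := by
    rw [← integral_const_mul_exp_mul c hl.ne']
    exact intervalIntegral.norm_integral_le_of_norm_le ht (ae_of_all _ hg)
      (Continuous.intervalIntegrable (by fun_prop) _ _)
  rw [norm_smul, Real.norm_of_nonneg (Real.exp_pos _).le]
  calc Real.exp (-(l * t)) * ‖∫ s in (0 : ℝ)..t, g s‖
      ≤ Real.exp (-(l * t)) * (c / l * Real.exp (l * t)) := by
        gcongr
        exact hint.trans (by gcongr; linarith)
    _ = c / l := by rw [mul_left_comm, ← Real.exp_add, neg_add_cancel, Real.exp_zero, mul_one]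

variable {F : ℝ → E → E} {K : NNReal} {B l : ℝ}

lemma continuous_apply_exp_smul (hF : Continuous (Function.uncurry F)) (l : ℝ) (Y : ℝ →ᵇ E) :
    Continuous fun s => F s (Real.exp (l * s) • Y s) :=
  hF.comp (by fun_prop : Continuous fun s => (s, Real.exp (l * s) • Y s))

lemma norm_apply_exp_smul_le (hLip : ∀ t, LipschitzWith K (F t)) (hB : ∀ t, ‖F t 0‖ ≤ B)
    (hl : 0 < l) (Y : ℝ →ᵇ E) {s : ℝ} (hs : 0 ≤ s) :
    ‖F s (Real.exp (l * s) • Y s)‖ ≤ (K * ‖Y‖ + B) * Real.exp (l * s) := by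
  have hexp : 1 ≤ Real.exp (l * s) := Real.one_le_exp (by positivity)
  have hB₀ : 0 ≤ B := (norm_nonneg _).trans (hB s)
  calc ‖F s (Real.exp (l * s) • Y s)‖
      ≤ K * (Real.exp (l * s) * ‖Y s‖) + ‖F s 0‖ := by
        simpa only [norm_smul, Real.norm_of_nonneg (Real.exp_pos _).le] using
          norm_le_of_lipschitzWith (hLip s) (Real.exp (l * s) • Y s)
    _ ≤ K * (Real.exp (l * s) * ‖Y‖) + B * Real.exp (l * s) := by
        gcongr
        · exact Y.norm_coe_le_norm s
        · exact (hB s).trans (le_mul_of_one_le_right hB₀ hexp)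
    _ = (K * ‖Y‖ + B) * Real.exp (l * s) := by ring

/-- The Picard map of `x' = F t x`, `x 0 = x₀` on `[0, ∞)`, conjugated by the weight `exp (l t)` so
that it acts on bounded functions. Negative times are clamped to `0`. -/
noncomputable def weightedPicardMap (hF : Continuous (Function.uncurry F))
    (hLip : ∀ t, LipschitzWith K (F t)) (hB : ∀ t, ‖F t 0‖ ≤ B) (hl : 0 < l) (x₀ : E)
    (Y : ℝ →ᵇ E) : ℝ →ᵇ E :=
  BoundedContinuousFunction.ofNormedAddCommGroup
    (fun t => Real.exp (-(l * max t 0)) •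
      (x₀ + ∫ s in (0 : ℝ)..max t 0, F s (Real.exp (l * s) • Y s)))
    ((by fun_prop : Continuous fun t : ℝ => Real.exp (-(l * max t 0))).smul
      (continuous_const.add ((intervalIntegral.continuous_primitive
        (fun _ _ => (continuous_apply_exp_smul hF l Y).intervalIntegrable _ _) 0).comp
          (by fun_prop))))
    (‖x₀‖ + (K * ‖Y‖ + B) / l) (fun t => by
      have hB₀ : 0 ≤ B := (norm_nonneg _).trans (hB t)
      have ht : 0 ≤ max t 0 := le_max_right _ _
      rw [smul_add]
      refine norm_add_le_of_le ?_ (norm_exp_neg_smul_integral_le hl ht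
        (fun s hs => norm_apply_exp_smul_le hLip hB hl Y hs.1.le) (by positivity))
      rw [norm_smul, Real.norm_of_nonneg (Real.exp_pos _).le]
      exact mul_le_of_le_one_left (norm_nonneg _)
        (Real.exp_le_one_iff.2 (neg_nonpos.2 (by positivity))))

lemma norm_weightedPicardMap_sub_le (hF : Continuous (Function.uncurry F))
    (hLip : ∀ t, LipschitzWith K (F t)) (hB : ∀ t, ‖F t 0‖ ≤ B) (hl : 0 < l) (x₀ : E)
    (Y Z : ℝ →ᵇ E) :
    ‖weightedPicardMap hF hLip hB hl x₀ Y - weightedPicardMap hF hLip hB hl x₀ Z‖ ≤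
      K / l * ‖Y - Z‖ := by
  refine (BoundedContinuousFunction.norm_le (by positivity)).2 fun t => ?_
  have hsub : (weightedPicardMap hF hLip hB hl x₀ Y - weightedPicardMap hF hLip hB hl x₀ Z) t =
      Real.exp (-(l * max t 0)) • ∫ s in (0 : ℝ)..max t 0,
        (F s (Real.exp (l * s) • Y s) - F s (Real.exp (l * s) • Z s)) := by
    rw [intervalIntegral.integral_sub ((continuous_apply_exp_smul hF l Y).intervalIntegrable _ _)
      ((continuous_apply_exp_smul hF l Z).intervalIntegrable _ _), ← add_sub_add_left_eq_sub _ _ x₀,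
      smul_sub]
    rfl
  rw [hsub, div_mul_eq_mul_div]
  refine norm_exp_neg_smul_integral_le hl (le_max_right _ _) (fun s _ => ?_) (by positivity)
  calc ‖F s (Real.exp (l * s) • Y s) - F s (Real.exp (l * s) • Z s)‖
      ≤ K * (Real.exp (l * s) * ‖(Y - Z) s‖) := by
        simpa only [← smul_sub, norm_smul, Real.norm_of_nonneg (Real.exp_pos _).le,
          BoundedContinuousFunction.coe_sub, Pi.sub_apply] using
          (hLip s).norm_sub_le (Real.exp (l * s) • Y s) (Real.exp (l * s) • Z s)
    _ ≤ K * (Real.exp (l * s) * ‖Y - Z‖) := by gcongr; exact (Y - Z).norm_coe_le_norm s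
    _ = K * ‖Y - Z‖ * Real.exp (l * s) := by ring

lemma exists_weightedPicardMap_fixedPoint [CompleteSpace E]
    (hF : Continuous (Function.uncurry F)) (hLip : ∀ t, LipschitzWith K (F t))
    (hB : ∀ t, ‖F t 0‖ ≤ B) (hl : 0 < l) (hKl : K < l) (x₀ : E) :
    ∃ Y, weightedPicardMap hF hLip hB hl x₀ Y = Y := by
  have hcontr : ContractingWith (K / l.toNNReal) (weightedPicardMap hF hLip hB hl x₀) := by
    refine ⟨?_, LipschitzWith.of_dist_le_mul fun Y Z => ?_⟩
    · rwa [div_lt_one (Real.toNNReal_pos.2 hl), ← NNReal.coe_lt_coe, Real.coe_toNNReal l hl.le]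
    · simpa only [dist_eq_norm, NNReal.coe_div, Real.coe_toNNReal l hl.le] using
        norm_weightedPicardMap_sub_le hF hLip hB hl x₀ Y Z
  exact ⟨_, hcontr.fixedPoint_isFixedPt⟩

lemma exists_hasDerivWithinAt_Ici_of_continuous_of_lipschitzWith [CompleteSpace E]
    (hF : Continuous (Function.uncurry F)) (hLip : ∀ t, LipschitzWith K (F t))
    (hB : ∀ t, ‖F t 0‖ ≤ B) (x₀ : E) :
    ∃ x : ℝ → E, x 0 = x₀ ∧ ∀ t, 0 ≤ t → HasDerivWithinAt x (F t (x t)) (Ici 0) t := by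
  set l : ℝ := K + 1
  obtain ⟨Y, hY⟩ := exists_weightedPicardMap_fixedPoint hF hLip hB (l := l) (by positivity)
    (lt_add_one _) x₀
  have hx : ∀ t, 0 ≤ t → Real.exp (l * t) • Y t =
      x₀ + ∫ s in (0 : ℝ)..t, F s (Real.exp (l * s) • Y s) := fun t ht => by
    conv_lhs => rw [← hY]
    simp only [weightedPicardMap, BoundedContinuousFunction.coe_ofNormedAddCommGroup,
      max_eq_left ht, smul_smul, ← Real.exp_add, add_neg_cancel, Real.exp_zero, one_smul]
  have hg := continuous_apply_exp_smul hF l Y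
  refine ⟨fun t => Real.exp (l * t) • Y t, ?_, fun t ht => ?_⟩
  · simpa only [intervalIntegral.integral_same, add_zero] using hx 0 le_rfl
  · exact ((hg.integral_hasStrictDerivAt 0 t).hasDerivAt.const_add x₀).hasDerivWithinAt.congr
      (fun s hs => hx s hs) (hx t ht)

theorem exists_hasDerivWithinAt_Ici_of_lipschitzWith [CompleteSpace E]
    (hF : ContinuousOn (Function.uncurry F) (Ici 0 ×ˢ univ))
    (hLip : ∀ t, 0 ≤ t → LipschitzWith K (F t)) (hB : ∀ t, 0 ≤ t → ‖F t 0‖ ≤ B) (x₀ : E) :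
    ∃ x : ℝ → E, x 0 = x₀ ∧ ∀ t, 0 ≤ t → HasDerivWithinAt x (F t (x t)) (Ici 0) t := by
  have hmax : ∀ t : ℝ, 0 ≤ max t 0 := fun t => le_max_right t 0
  have hFmax : Continuous (Function.uncurry fun t => F (max t 0)) :=
    hF.comp_continuous (f := fun z : ℝ × E => (max z.1 0, z.2)) (by fun_prop)
      fun z => ⟨hmax z.1, mem_univ _⟩
  obtain ⟨x, hx₀, hx⟩ := exists_hasDerivWithinAt_Ici_of_continuous_of_lipschitzWith hFmax
    (fun t => hLip _ (hmax t)) (fun t => hB _ (hmax t)) x₀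
  exact ⟨x, hx₀, fun t ht => by simpa only [max_eq_left ht] using hx t ht⟩

theorem eq_of_hasDerivWithinAt_Ici_of_lipschitzWith (hLip : ∀ t, 0 ≤ t → LipschitzWith K (F t))
    {x y : ℝ → E} (hx : ∀ t, 0 ≤ t → HasDerivWithinAt x (F t (x t)) (Ici 0) t)
    (hy : ∀ t, 0 ≤ t → HasDerivWithinAt y (F t (y t)) (Ici 0) t) (h₀ : x 0 = y 0) {t : ℝ}
    (ht : 0 ≤ t) : x t = y t :=
  ODE_solution_unique_of_mem_Icc_right (s := fun _ => univ)
    (fun s hs => (hLip s hs.1).lipschitzOnWith)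
    (fun s hs => (hx s hs.1).continuousWithinAt.mono Icc_subset_Ici_self)
    (fun s hs => (hx s hs.1).mono (Ici_subset_Ici.2 hs.1)) (fun _ _ => mem_univ _)
    (fun s hs => (hy s hs.1).continuousWithinAt.mono Icc_subset_Ici_self)
    (fun s hs => (hy s hs.1).mono (Ici_subset_Ici.2 hs.1)) (fun _ _ => mem_univ _) h₀
    (right_mem_Icc.2 ht)

end LipschitzODE

section PeriodSquare

/-- The period square `[-π, π]²` over which `torusL1` integrates. -/
abbrev torusBox : Set (ℝ × ℝ) := Icc (-Real.pi) Real.pi ×ˢ Icc (-Real.pi) Real.pi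

lemma isCompact_torusBox : IsCompact torusBox := isCompact_Icc.prod isCompact_Icc

lemma measurableSet_torusBox : MeasurableSet torusBox := isCompact_torusBox.measurableSet

lemma integrableOn_torusBox {f : ℝ × ℝ → ℝ} (hf : Continuous f) : IntegrableOn f torusBox :=
  hf.continuousOn.integrableOn_compact isCompact_torusBox

lemma integral_torusBox_eq_intervalIntegral {f : ℝ × ℝ → ℝ} (hf : Continuous f) :
    ∫ p in torusBox, f p =
      ∫ x in (-Real.pi)..Real.pi, ∫ y in (-Real.pi)..Real.pi, f (x, y) := by
  have hpi : -Real.pi ≤ Real.pi := by linarith [Real.pi_pos]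
  rw [Measure.volume_eq_prod, setIntegral_prod _ (integrableOn_torusBox hf)]
  simp_rw [intervalIntegral.integral_of_le hpi, integral_Icc_eq_integral_Ioc]

namespace IsTorusPeriodic

variable {f g : ℝ × ℝ → ℝ}

lemma iff_periodic : IsTorusPeriodic f ↔
    Function.Periodic f (2 * Real.pi, 0) ∧ Function.Periodic f (0, 2 * Real.pi) := by
  simp only [IsTorusPeriodic, Function.Periodic, Prod.forall, Prod.mk_add_mk, add_zero,
    forall_and]

lemma comp (hf : IsTorusPeriodic f) (F : ℝ → ℝ) : IsTorusPeriodic fun p => F (f p) :=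
  iff_periodic.2 ⟨(iff_periodic.1 hf).1.comp F, (iff_periodic.1 hf).2.comp F⟩

lemma sub (hf : IsTorusPeriodic f) (hg : IsTorusPeriodic g) :
    IsTorusPeriodic fun p => f p - g p :=
  iff_periodic.2 ⟨(iff_periodic.1 hf).1.sub (iff_periodic.1 hg).1,
    (iff_periodic.1 hf).2.sub (iff_periodic.1 hg).2⟩

lemma mul (hf : IsTorusPeriodic f) (hg : IsTorusPeriodic g) :
    IsTorusPeriodic fun p => f p * g p :=
  iff_periodic.2 ⟨(iff_periodic.1 hf).1.mul (iff_periodic.1 hg).1,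
    (iff_periodic.1 hf).2.mul (iff_periodic.1 hg).2⟩

lemma sub_zsmul_eq (hf : IsTorusPeriodic f) (k : ℤ × ℤ) (p : ℝ × ℝ) :
    f (p - (k.1 • (2 * Real.pi), k.2 • (2 * Real.pi))) = f p := by
  have hsplit : p - (k.1 • (2 * Real.pi), k.2 • (2 * Real.pi)) =
      p - k.1 • (2 * Real.pi, (0 : ℝ)) - k.2 • ((0 : ℝ), 2 * Real.pi) := by ext <;> simp
  rw [hsplit, (iff_periodic.1 hf).2.sub_zsmul_eq, (iff_periodic.1 hf).1.sub_zsmul_eq]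

lemma integral_comp_add_right (hf : IsTorusPeriodic f) (hfc : Continuous f) (a : ℝ × ℝ) :
    ∫ p in torusBox, f (p + a) = ∫ p in torusBox, f p := by
  have hshift : ∀ {g : ℝ → ℝ}, Function.Periodic g (2 * Real.pi) → ∀ c,
      ∫ x in (-Real.pi)..Real.pi, g (x + c) = ∫ x in (-Real.pi)..Real.pi, g x := fun hg c => by
    rw [intervalIntegral.integral_comp_add_right]
    convert hg.intervalIntegral_add_eq (-Real.pi + c) (-Real.pi) using 2 <;> ring
  rw [integral_torusBox_eq_intervalIntegral hfc,
    integral_torusBox_eq_intervalIntegral (f := fun p => f (p + a)) (by fun_prop)]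
  calc ∫ x in (-Real.pi)..Real.pi, ∫ y in (-Real.pi)..Real.pi, f (x + a.1, y + a.2)
      = ∫ x in (-Real.pi)..Real.pi, ∫ y in (-Real.pi)..Real.pi, f (x + a.1, y) := by
        congr 1 with x
        exact hshift (g := fun y => f (x + a.1, y)) (fun y => (hf _ y).2) a.2
    _ = ∫ x in (-Real.pi)..Real.pi, ∫ y in (-Real.pi)..Real.pi, f (x, y) :=
        hshift (g := fun x => ∫ y in (-Real.pi)..Real.pi, f (x, y))
          (fun x => by simp only [(hf x _).1]) a.1

lemma torusL1_comp_add_right (hf : IsTorusPeriodic f) (hfc : Continuous f) (a : ℝ × ℝ) :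
    torusL1 (fun p => f (p + a)) = torusL1 f :=
  (hf.comp abs).integral_comp_add_right hfc.abs a

end IsTorusPeriodic

end PeriodSquare

section TorusNorm

variable {f g : ℝ × ℝ → ℝ}

lemma torusL1_nonneg (f : ℝ × ℝ → ℝ) : 0 ≤ torusL1 f := integral_nonneg fun _ => abs_nonneg _

lemma torusL1_mono (hf : Continuous f) (hg : Continuous g) (h : ∀ p, |f p| ≤ |g p|) :
    torusL1 f ≤ torusL1 g :=
  setIntegral_mono (integrableOn_torusBox hf.abs) (integrableOn_torusBox hg.abs) h

lemma torusL1_const (c : ℝ) : torusL1 (fun _ => c) = (2 * Real.pi) ^ 2 * |c| := by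
  rw [torusL1, integral_torusBox_eq_intervalIntegral continuous_const]
  simp only [intervalIntegral.integral_const, smul_eq_mul]
  ring

lemma torusL1_add_le (hf : Continuous f) (hg : Continuous g) :
    torusL1 (fun p => f p + g p) ≤ torusL1 f + torusL1 g := by
  have hf' := integrableOn_torusBox hf.abs
  have hg' := integrableOn_torusBox hg.abs
  rw [torusL1, torusL1, torusL1, ← integral_add hf' hg']
  exact setIntegral_mono (integrableOn_torusBox (hf.add hg).abs) (hf'.add hg')
    fun p => abs_add_le _ _

lemma torusL1_const_mul (c : ℝ) (f : ℝ × ℝ → ℝ) :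
    torusL1 (fun p => c * f p) = |c| * torusL1 f := by
  simp only [torusL1, abs_mul, integral_const_mul]

lemma torusL1_le_norm (f : ℝ × ℝ →ᵇ ℝ) : torusL1 f ≤ (2 * Real.pi) ^ 2 * ‖f‖ := by
  calc torusL1 f ≤ torusL1 fun _ => ‖f‖ := torusL1_mono f.continuous continuous_const fun p => by
        rw [abs_norm]
        exact f.norm_coe_le_norm p
    _ = (2 * Real.pi) ^ 2 * ‖f‖ := by rw [torusL1_const, abs_norm]

/-- The `L¹(𝕋²)` norm, as a seminorm on the bounded continuous functions of the plane. -/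
noncomputable def torusSeminorm : Seminorm ℝ (ℝ × ℝ →ᵇ ℝ) :=
  Seminorm.of (fun f => torusL1 f) (fun f g => torusL1_add_le f.continuous g.continuous)
    fun c f => torusL1_const_mul c f

lemma continuous_torusSeminorm : Continuous torusSeminorm :=
  Seminorm.continuous_of_le (q := ((2 * Real.pi) ^ 2).toNNReal • normSeminorm ℝ (ℝ × ℝ →ᵇ ℝ))
    (by exact (continuous_const_smul _).comp continuous_norm)
    fun f => (torusL1_le_norm f).trans_eq <| by
      change _ = ((((2 * Real.pi) ^ 2).toNNReal : NNReal) : ℝ) * ‖f‖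
      rw [Real.coe_toNNReal _ (sq_nonneg _)]

end TorusNorm

section Covering

lemma setIntegral_le_card_mul_of_cover {G ι : Type*} [AddGroup G] [MeasurableSpace G]
    [MeasurableAdd G] {μ : Measure G} [μ.IsAddRightInvariant] {s B : Set G} (hs : MeasurableSet s)
    (hB : MeasurableSet B) {S : Finset ι} {a : ι → G} (hcover : ∀ p ∈ s, ∃ i ∈ S, p - a i ∈ B)
    {g : G → ℝ} (hg : ∀ p, 0 ≤ g p) (hgB : IntegrableOn g B μ) (hper : ∀ i p, g (p - a i) = g p) :
    ∫ p in s, g p ∂μ ≤ S.card * ∫ p in B, g p ∂μ := by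
  have hB₀ : ∀ p, 0 ≤ B.indicator g p := indicator_nonneg fun p _ => hg p
  have hint : Integrable (B.indicator g) μ := (integrable_indicator_iff hB).2 hgB
  have hle : ∀ p, s.indicator g p ≤ ∑ i ∈ S, B.indicator g (p - a i) := fun p => by
    refine indicator_le' (g := fun p => ∑ i ∈ S, B.indicator g (p - a i)) (fun q hq => ?_)
      (fun q _ => Finset.sum_nonneg fun i _ => hB₀ _) p
    obtain ⟨i, hi, hiB⟩ := hcover q hq
    calc g q = B.indicator g (q - a i) := by rw [indicator_of_mem hiB, hper]
      _ ≤ _ := Finset.single_le_sum (f := fun i => B.indicator g (q - a i)) (fun i _ => hB₀ _) hi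
  calc ∫ p in s, g p ∂μ = ∫ p, s.indicator g p ∂μ := (integral_indicator hs).symm
    _ ≤ ∫ p, ∑ i ∈ S, B.indicator g (p - a i) ∂μ :=
        integral_mono_of_nonneg (ae_of_all _ fun p => indicator_nonneg (fun p _ => hg p) p)
          (integrable_finsetSum S fun i _ => hint.comp_sub_right (a i)) (ae_of_all _ hle)
    _ = S.card * ∫ p in B, g p ∂μ := by
        rw [integral_finsetSum S fun i _ => hint.comp_sub_right (a i)]
        simp only [integral_sub_right_eq_self, integral_indicator hB, Finset.sum_const,
          nsmul_eq_mul]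

lemma sub_round_zsmul_mem_Icc (x : ℝ) :
    x - round (x / (2 * Real.pi)) • (2 * Real.pi) ∈ Icc (-Real.pi) Real.pi := by
  have hpi : 0 < 2 * Real.pi := by positivity
  have hround := mul_le_mul_of_nonneg_right (abs_sub_round (x / (2 * Real.pi))) hpi.le
  rw [← abs_of_pos hpi, ← abs_mul, abs_of_pos hpi, sub_mul, div_mul_cancel₀ _ hpi.ne',
    one_div_mul_eq_div, mul_div_cancel_left₀ _ two_ne_zero] at hround
  rw [zsmul_eq_mul]
  exact abs_le.1 hround

lemma abs_round_sub_round_le {R x c : ℝ} (h : |x - c| ≤ R) :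
    |round (x / (2 * Real.pi)) - round (c / (2 * Real.pi))| ≤ ⌈R⌉ + 1 := by
  have hpi : 1 ≤ 2 * Real.pi := by linarith [Real.pi_gt_three]
  have hdiff : |x / (2 * Real.pi) - c / (2 * Real.pi)| ≤ ⌈R⌉ := by
    rw [← sub_div, abs_div, abs_of_pos (by positivity : 0 < 2 * Real.pi)]
    exact (div_le_self (abs_nonneg _) hpi).trans (h.trans (Int.le_ceil R))
  have hx := abs_le.1 (abs_sub_round (x / (2 * Real.pi)))
  have hc := abs_le.1 (abs_sub_round (c / (2 * Real.pi)))
  have hd := abs_le.1 hdiff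
  have hcast : |((round (x / (2 * Real.pi)) - round (c / (2 * Real.pi)) : ℤ) : ℝ)| ≤
      ((⌈R⌉ + 1 : ℤ) : ℝ) := by
    push_cast
    exact abs_le.2 ⟨by linarith, by linarith⟩
  exact_mod_cast hcast

lemma exists_setIntegral_closedBall_le_torusL1 (R : ℝ) : ∃ n : ℝ, 0 ≤ n ∧
    ∀ f : ℝ × ℝ → ℝ, IsTorusPeriodic f → LocallyIntegrable f →
      ∀ c, ∫ p in Metric.closedBall c R, |f p| ≤ n * torusL1 f := by
  set m : ℤ := ⌈R⌉ + 1
  refine ⟨(Finset.Icc (-m) m ×ˢ Finset.Icc (-m) m).card, by positivity, fun f hf hfi c => ?_⟩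
  set k : ℝ × ℝ → ℤ × ℤ := fun p => (round (p.1 / (2 * Real.pi)), round (p.2 / (2 * Real.pi)))
  refine setIntegral_le_card_mul_of_cover
    (a := fun i => ((i + k c).1 • (2 * Real.pi), (i + k c).2 • (2 * Real.pi)))
    measurableSet_closedBall measurableSet_torusBox (fun p hp => ⟨k p - k c, ?_, ?_⟩)
    (fun p => abs_nonneg _) (hfi.integrableOn_isCompact isCompact_torusBox).abs
    fun i p => by rw [hf.sub_zsmul_eq]
  · rw [mem_closedBall_iff_norm, Prod.norm_def, max_le_iff] at hp
    rw [Finset.mem_product, Finset.mem_Icc, Finset.mem_Icc, ← abs_le, ← abs_le]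
    exact ⟨abs_round_sub_round_le hp.1, abs_round_sub_round_le hp.2⟩
  · rw [sub_add_cancel]
    exact ⟨sub_round_zsmul_mem_Icc p.1, sub_round_zsmul_mem_Icc p.2⟩

end Covering

section PartialDerivatives

lemma partialX_eq_fderiv {f : ℝ × ℝ → ℝ} {p : ℝ × ℝ} (hf : DifferentiableAt ℝ f p) :
    partialX f p = fderiv ℝ f p (1, 0) :=
  (hf.hasFDerivAt.comp_hasDerivAt p.1
    ((hasDerivAt_id p.1).prodMk (hasDerivAt_const p.1 p.2))).deriv

lemma partialY_eq_fderiv {f : ℝ × ℝ → ℝ} {p : ℝ × ℝ} (hf : DifferentiableAt ℝ f p) :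
    partialY f p = fderiv ℝ f p (0, 1) :=
  (hf.hasFDerivAt.comp_hasDerivAt p.2
    ((hasDerivAt_const p.2 p.1).prodMk (hasDerivAt_id p.2))).deriv

namespace IsTestFunction

variable {ψ : ℝ × ℝ → ℝ}

lemma contDiff_one (hψ : IsTestFunction ψ) : ContDiff ℝ 1 ψ := hψ.1.of_le (by exact_mod_cast le_top)

lemma continuous (hψ : IsTestFunction ψ) : Continuous ψ := hψ.1.continuous

lemma differentiable (hψ : IsTestFunction ψ) : Differentiable ℝ ψ :=
  hψ.contDiff_one.differentiable one_ne_zero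

lemma fderiv_apply (hψ : IsTestFunction ψ) (e : ℝ × ℝ) :
    IsTestFunction fun p => fderiv ℝ ψ p e :=
  ⟨(hψ.1.fderiv_right (by norm_num)).clm_apply contDiff_const, hψ.2.fderiv_apply ℝ e⟩

lemma partialX_eq (hψ : IsTestFunction ψ) : partialX ψ = fun p => fderiv ℝ ψ p (1, 0) :=
  funext fun p => partialX_eq_fderiv (hψ.differentiable p)

lemma partialY_eq (hψ : IsTestFunction ψ) : partialY ψ = fun p => fderiv ℝ ψ p (0, 1) :=
  funext fun p => partialY_eq_fderiv (hψ.differentiable p)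

lemma partialX (hψ : IsTestFunction ψ) : IsTestFunction (partialX ψ) :=
  hψ.partialX_eq ▸ hψ.fderiv_apply _

lemma partialY (hψ : IsTestFunction ψ) : IsTestFunction (partialY ψ) :=
  hψ.partialY_eq ▸ hψ.fderiv_apply _

end IsTestFunction

lemma exists_norm_le_of_hasCompactSupport {E F : Type*} [SeminormedAddCommGroup E] [Zero F]
    {k : E → F} (hk : HasCompactSupport k) : ∃ R : ℝ, 0 ≤ R ∧ ∀ p, k p ≠ 0 → ‖p‖ ≤ R := by
  obtain ⟨R, hR⟩ := hk.isCompact.isBounded.subset_closedBall 0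
  refine ⟨max R 0, le_max_right _ _, fun p hp => ?_⟩
  exact (mem_closedBall_zero_iff.1 (hR (subset_tsupport _ hp))).trans (le_max_left _ _)

end PartialDerivatives

lemma abs_integral_le_of_abs_le {Ω : Type*} [MeasurableSpace Ω] {μ : Measure Ω} {f g : Ω → ℝ}
    (hg : Integrable g μ) (hfg : ∀ x, |f x| ≤ g x) : |∫ x, f x ∂μ| ≤ ∫ x, g x ∂μ := by
  rw [← Real.norm_eq_abs]
  exact norm_integral_le_of_norm_le hg (ae_of_all _ hfg)

section Convolution

variable {E : Type*} [NormedAddCommGroup E] [MeasurableSpace E] {μ : Measure E}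
  {f g k : E → ℝ}

/-- The convolution `f * k` of real functions, the one in which `mollified` is expressed. -/
noncomputable abbrev realConv (f k : E → ℝ) (μ : Measure E) : E → ℝ :=
  convolution f k (ContinuousLinearMap.mul ℝ ℝ) μ

lemma realConv_apply (f k : E → ℝ) (p : E) : realConv f k μ p = ∫ q, f q * k (p - q) ∂μ := rfl

lemma abs_realConv_mul_sub_le [BorelSpace E] [IsFiniteMeasureOnCompacts μ] {Λ : NNReal} {r : ℝ}
    (hf : Continuous f) (hg : LipschitzWith Λ g) (hk : Continuous k) (hkc : HasCompactSupport k)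
    (hr : ∀ p, k p ≠ 0 → ‖p‖ ≤ r) (p : E) :
    |realConv (fun q => f q * g q) k μ p - g p * realConv f k μ p| ≤
      Λ * r * realConv (fun q => |f q|) (fun q => |k q|) μ p := by
  have hint : ∀ {φ κ : E → ℝ}, Continuous φ → Continuous κ → HasCompactSupport κ →
      Integrable (fun q => φ q * κ (p - q)) μ := fun hφ hκ hκc =>
    Continuous.integrable_of_hasCompactSupport (by fun_prop)
      ((hκc.comp_homeomorph (Homeomorph.subLeft p)).mul_left)
  simp only [realConv_apply]
  rw [← integral_const_mul, ← integral_const_mul, ← integral_sub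
    (hint (φ := fun q => f q * g q) (hf.mul hg.continuous) hk hkc) ((hint hf hk hkc).const_mul _)]
  refine abs_integral_le_of_abs_le
    ((hint hf.abs hk.abs (hkc.comp_left abs_zero)).const_mul _) fun q => ?_
  rw [show f q * g q * k (p - q) - g p * (f q * k (p - q)) =
    (g q - g p) * (f q * k (p - q)) by ring, abs_mul, abs_mul]
  by_cases hzero : k (p - q) = 0
  · simp [hzero]
  · gcongr
    calc |g q - g p| ≤ Λ * dist q p := hg.dist_le_mul q p
      _ ≤ Λ * r := by
        rw [dist_comm, dist_eq_norm]
        gcongr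
        exact hr _ hzero

variable [BorelSpace E] [NormedSpace ℝ E] [FiniteDimensional ℝ E] [μ.IsAddHaarMeasure]

lemma realConv_apply_swap (f k : E → ℝ) (p : E) :
    realConv f k μ p = ∫ q, f (p - q) * k q ∂μ :=
  convolution_eq_swap _

lemma realConv_add_const (f k : E → ℝ) (a p : E) :
    realConv f k μ (p + a) = realConv (fun q => f (q + a)) k μ p := by
  simp only [realConv_apply_swap, add_sub_right_comm]

lemma continuous_realConv (hf : Continuous f) (hk : Continuous k) (hkc : HasCompactSupport k) :
    Continuous (realConv f k μ) :=
  hkc.continuous_convolution_right _ hf.locallyIntegrable hk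

lemma abs_realConv_le_mul_norm (f : E →ᵇ ℝ) (hk : Integrable k μ) (p : E) :
    |realConv f k μ p| ≤ (∫ q, |k q| ∂μ) * ‖f‖ := by
  rw [realConv_apply_swap, mul_comm, ← integral_const_mul]
  refine abs_integral_le_of_abs_le (hk.abs.const_mul _) fun q => ?_
  rw [abs_mul]
  gcongr
  exact f.norm_coe_le_norm _

/-- Convolution with a continuous compactly supported kernel, as a bounded operator on bounded
continuous functions; it transports time derivatives of `X` to time derivatives of `X * k`. -/
noncomputable def convCLM (μ : Measure E) [μ.IsAddHaarMeasure] (k : E → ℝ) (hk : Continuous k)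
    (hkc : HasCompactSupport k) : (E →ᵇ ℝ) →L[ℝ] (E →ᵇ ℝ) :=
  have hint : Integrable k μ := hk.integrable_of_hasCompactSupport hkc
  LinearMap.mkContinuous
    { toFun := fun f => BoundedContinuousFunction.ofNormedAddCommGroup (realConv f k μ)
        (continuous_realConv f.continuous hk hkc) _ (abs_realConv_le_mul_norm f hint)
      map_add' := fun f g => DFunLike.coe_injective <|
        ConvolutionExists.add_distrib
          (hkc.convolutionExists_right _ f.continuous.locallyIntegrable hk)
          (hkc.convolutionExists_right _ g.continuous.locallyIntegrable hk)
      map_smul' := fun _ _ => DFunLike.coe_injective <| smul_convolution }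
    (∫ q, |k q| ∂μ) fun f =>
      BoundedContinuousFunction.norm_ofNormedAddCommGroup_le _
        (mul_nonneg (integral_nonneg fun _ => abs_nonneg _) (norm_nonneg _))
        (abs_realConv_le_mul_norm f hint)

lemma convCLM_apply (hk : Continuous k) (hkc : HasCompactSupport k) (f : E →ᵇ ℝ) (p : E) :
    convCLM μ k hk hkc f p = realConv f k μ p :=
  rfl

lemma setIntegral_abs_realConv_le {s : Set E} (hs : IsCompact s) (hf : Continuous f)
    (hk : Continuous k) (hkc : HasCompactSupport k) :
    ∫ p in s, |realConv f k μ p| ∂μ ≤ ∫ q, (∫ p in s, |f (p - q)| ∂μ) * |k q| ∂μ := by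
  have hcont : Continuous (Function.uncurry fun p q : E => |f (p - q)| * |k q|) := by
    unfold Function.uncurry
    fun_prop
  have hint : Integrable (Function.uncurry fun p q : E => |f (p - q)| * |k q|)
      ((μ.restrict s).prod μ) := by
    have hprod : (μ.restrict s).prod μ = (μ.prod μ).restrict (s ×ˢ univ) := by
      rw [← Measure.prod_restrict, Measure.restrict_univ]
    rw [hprod]
    refine (hcont.continuousOn.integrableOn_compact
      (hs.prod hkc.isCompact)).of_forall_sdiff_eq_zero (hs.measurableSet.prod .univ) fun x hx => ?_
    have hxk : x.2 ∉ tsupport k := fun h => hx.2 ⟨hx.1.1, h⟩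
    simp [Function.uncurry, image_eq_zero_of_notMem_tsupport hxk]
  calc ∫ p in s, |realConv f k μ p| ∂μ ≤ ∫ p in s, ∫ q, |f (p - q)| * |k q| ∂μ ∂μ := by
        refine setIntegral_mono
          ((continuous_realConv hf hk hkc).abs.continuousOn.integrableOn_compact hs)
          hint.integral_prod_left fun p => ?_
        simp only [realConv_apply_swap, ← abs_mul]
        exact abs_integral_le_integral_abs
    _ = ∫ q, ∫ p in s, |f (p - q)| * |k q| ∂μ ∂μ := integral_integral_swap hint
    _ = ∫ q, (∫ p in s, |f (p - q)| ∂μ) * |k q| ∂μ := by simp_rw [integral_mul_const]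

lemma fderiv_realConv_apply (hf : Continuous f) (hk : ContDiff ℝ 1 k) (hkc : HasCompactSupport k)
    (p e : E) : fderiv ℝ (realConv f k μ) p e = realConv f (fun q => fderiv ℝ k q e) μ p := by
  rw [(hkc.hasFDerivAt_convolution_right _ hf.locallyIntegrable hk p).fderiv,
    convolution_precompR_apply _ hf.locallyIntegrable (hkc.fderiv ℝ)
      (hk.continuous_fderiv one_ne_zero)]

end Convolution

section PlaneConvolution

variable {f k : ℝ × ℝ → ℝ}

lemma IsTorusPeriodic.realConv (hf : IsTorusPeriodic f) (k : ℝ × ℝ → ℝ) :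
    IsTorusPeriodic (realConv f k volume) := by
  rw [IsTorusPeriodic.iff_periodic] at hf ⊢
  exact ⟨fun p => by rw [realConv_add_const, hf.1.funext],
    fun p => by rw [realConv_add_const, hf.2.funext]⟩

lemma torusL1_realConv_le (hp : IsTorusPeriodic f) (hf : Continuous f) (hk : Continuous k)
    (hkc : HasCompactSupport k) : torusL1 (realConv f k volume) ≤ torusL1 f * ∫ q, |k q| := by
  refine (setIntegral_abs_realConv_le isCompact_torusBox hf hk hkc).trans_eq ?_
  simp_rw [sub_eq_add_neg, ← integral_const_mul]
  exact integral_congr_ae (ae_of_all _ fun q =>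
    congrArg (· * |k q|) (hp.torusL1_comp_add_right hf (-q)))

lemma contDiff_realConv (hf : Continuous f) (hk : IsTestFunction k) :
    ContDiff ℝ ∞ (realConv f k volume) :=
  hk.2.contDiff_convolution_right _ hf.locallyIntegrable hk.1

lemma partialX_realConv (hf : Continuous f) (hk : IsTestFunction k) :
    partialX (realConv f k volume) = realConv f (partialX k) volume := by
  funext p
  rw [partialX_eq_fderiv ((contDiff_realConv hf hk).differentiable (by simp) p),
    fderiv_realConv_apply hf hk.contDiff_one hk.2, hk.partialX_eq]

lemma partialY_realConv (hf : Continuous f) (hk : IsTestFunction k) :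
    partialY (realConv f k volume) = realConv f (partialY k) volume := by
  funext p
  rw [partialY_eq_fderiv ((contDiff_realConv hf hk).differentiable (by simp) p),
    fderiv_realConv_apply hf hk.contDiff_one hk.2, hk.partialY_eq]

end PlaneConvolution

section ScaledKernel

variable {k : ℝ × ℝ → ℝ} {h : ℝ}

lemma scaledKernel_eq (k : ℝ × ℝ → ℝ) (h : ℝ) :
    scaledKernel k h = fun p => 1 / h ^ 2 * k (h⁻¹ • p) := by
  funext p
  simp only [scaledKernel, Prod.smul_def, smul_eq_mul, div_eq_inv_mul]

lemma continuous_scaledKernel (hk : Continuous k) (h : ℝ) : Continuous (scaledKernel k h) := by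
  rw [scaledKernel_eq]
  fun_prop

lemma hasCompactSupport_scaledKernel (hk : HasCompactSupport k) (hh : h ≠ 0) :
    HasCompactSupport (scaledKernel k h) := by
  rw [scaledKernel_eq]
  exact (hk.comp_smul (inv_ne_zero hh)).mul_left

lemma isTestFunction_scaledKernel (hk : IsTestFunction k) (hh : h ≠ 0) :
    IsTestFunction (scaledKernel k h) := by
  refine ⟨?_, hasCompactSupport_scaledKernel hk.2 hh⟩
  rw [scaledKernel_eq]
  exact contDiff_const.mul (hk.1.comp (contDiff_const_smul _))

lemma norm_le_of_scaledKernel_ne_zero {R : ℝ} (hR : ∀ p, k p ≠ 0 → ‖p‖ ≤ R) (hh : 0 < h)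
    {p : ℝ × ℝ} (hp : scaledKernel k h p ≠ 0) : ‖p‖ ≤ R * h := by
  rw [scaledKernel_eq] at hp
  have hnorm := hR _ (right_ne_zero_of_mul hp)
  rwa [norm_smul, norm_inv, Real.norm_of_nonneg hh.le, inv_mul_le_iff₀ hh, mul_comm] at hnorm

lemma integral_scaledKernel (k : ℝ × ℝ → ℝ) (hh : h ≠ 0) :
    ∫ p, scaledKernel k h p = ∫ p, k p := by
  rw [scaledKernel_eq, integral_const_mul, Measure.integral_comp_inv_smul]
  simp only [Module.finrank_prod, Module.finrank_self, one_add_one_eq_two, abs_pow, sq_abs,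
    smul_eq_mul]
  field_simp

lemma abs_scaledKernel (k : ℝ × ℝ → ℝ) (h : ℝ) (p : ℝ × ℝ) :
    |scaledKernel k h p| = scaledKernel (fun q => |k q|) h p := by
  rw [scaledKernel, scaledKernel, abs_mul, abs_of_nonneg (by positivity)]

lemma integral_abs_scaledKernel (k : ℝ × ℝ → ℝ) (hh : h ≠ 0) :
    ∫ p, |scaledKernel k h p| = ∫ p, |k p| := by
  simp_rw [abs_scaledKernel]
  exact integral_scaledKernel _ hh

lemma fderiv_scaledKernel_apply (k : ℝ × ℝ → ℝ) (h : ℝ) (p e : ℝ × ℝ) :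
    fderiv ℝ (scaledKernel k h) p e =
      1 / h * scaledKernel (fun q => fderiv ℝ k q e) h p := by
  simp only [scaledKernel_eq]
  change fderiv ℝ ((1 / h ^ 2) • fun p => k (h⁻¹ • p)) p e = _
  rw [fderiv_const_smul_field, Pi.smul_apply, fderiv_comp_smul]
  simp only [smul_apply, smul_eq_mul]
  ring

lemma partialX_scaledKernel (hk : IsTestFunction k) (hh : h ≠ 0) :
    partialX (scaledKernel k h) = fun p => 1 / h * scaledKernel (partialX k) h p := by
  funext p
  rw [(isTestFunction_scaledKernel hk hh).partialX_eq, hk.partialX_eq]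
  exact fderiv_scaledKernel_apply k h p _

lemma partialY_scaledKernel (hk : IsTestFunction k) (hh : h ≠ 0) :
    partialY (scaledKernel k h) = fun p => 1 / h * scaledKernel (partialY k) h p := by
  funext p
  rw [(isTestFunction_scaledKernel hk hh).partialY_eq, hk.partialY_eq]
  exact fderiv_scaledKernel_apply k h p _

lemma abs_scaledKernel_le {c : ℝ} (hc : ∀ p, |k p| ≤ c) (h : ℝ) (p : ℝ × ℝ) :
    |scaledKernel k h p| ≤ c / h ^ 2 := by
  rw [abs_scaledKernel, scaledKernel, div_eq_mul_one_div c, mul_comm c]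
  gcongr
  exact hc _

lemma exists_abs_realConv_scaledKernel_le (hk : Continuous k) (hkc : HasCompactSupport k) :
    ∃ C : ℝ, 0 ≤ C ∧ ∀ h : ℝ, 0 < h → h ≤ 1 → ∀ f : ℝ × ℝ → ℝ, IsTorusPeriodic f →
      Continuous f → ∀ p, |realConv f (scaledKernel k h) volume p| ≤ C * torusL1 f / h ^ 2 := by
  obtain ⟨R, hR₀, hR⟩ := exists_norm_le_of_hasCompactSupport hkc
  obtain ⟨n, hn, hball⟩ := exists_setIntegral_closedBall_le_torusL1 R
  obtain ⟨c, hc⟩ := hk.bounded_above_of_compact_support hkc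
  have hc₀ : 0 ≤ c := (norm_nonneg _).trans (hc 0)
  refine ⟨c * n, by positivity, fun h hh hh₁ f hp hf p => ?_⟩
  have hdom : ∀ q, |f q * scaledKernel k h (p - q)| ≤
      (Metric.closedBall p R).indicator (fun q : ℝ × ℝ => c / h ^ 2 * |f q|) q := fun q => by
    by_cases hzero : scaledKernel k h (p - q) = 0
    · rw [hzero, mul_zero, abs_zero]
      exact indicator_nonneg (fun _ _ => by positivity) _
    · have hq : q ∈ Metric.closedBall p R := mem_closedBall_iff_norm'.2 <|
        (norm_le_of_scaledKernel_ne_zero hR hh hzero).trans (mul_le_of_le_one_right hR₀ hh₁)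
      rw [indicator_of_mem hq, abs_mul, mul_comm]
      gcongr
      exact abs_scaledKernel_le hc h _
  have hint : IntegrableOn (fun q => c / h ^ 2 * |f q|) (Metric.closedBall p R) :=
    (hf.abs.const_mul _).continuousOn.integrableOn_compact (isCompact_closedBall _ _)
  calc |realConv f (scaledKernel k h) volume p|
      ≤ ∫ q in Metric.closedBall p R, c / h ^ 2 * |f q| := by
        rw [realConv_apply, ← integral_indicator measurableSet_closedBall]
        exact abs_integral_le_of_abs_le
          ((integrable_indicator_iff measurableSet_closedBall).2 hint) hdom
    _ ≤ c / h ^ 2 * (n * torusL1 f) := by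
        rw [integral_const_mul]
        gcongr
        exact hball f hp hf.locallyIntegrable p
    _ = c * n * torusL1 f / h ^ 2 := by ring

end ScaledKernel

section SeminormGrowth

variable {E : Type*} [NormedAddCommGroup E] [NormedSpace ℝ E] {p : Seminorm ℝ E}

lemma eventually_slope_lt_of_euler_step_le (hp : Continuous p) {x : ℝ → E} {D b : E} {s r : ℝ}
    (hx : HasDerivWithinAt x (D + b) (Ioi s) s)
    (hD : ∀ᶠ h in 𝓝[>] (0 : ℝ), p (x s + h • D) ≤ p (x s)) (hr : p b < r) :
    ∀ᶠ z in 𝓝[>] s, slope (fun t => p (x t)) s z < r := by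
  have hslope : Tendsto (fun z => p (slope x s z - (D + b))) (𝓝[>] s) (𝓝 0) := by
    have hlim := (hasDerivWithinAt_iff_tendsto_slope' self_notMem_Ioi).1 hx
    simpa only [sub_self, map_zero, Function.comp_def] using
      (hp.tendsto _).comp (hlim.sub_const (D + b))
  have hshift : Tendsto (fun z => z - s) (𝓝[>] s) (𝓝[>] 0) :=
    tendsto_nhdsWithin_iff.2
      ⟨((continuous_sub_right s).tendsto' s 0 (sub_self s)).mono_left nhdsWithin_le_nhds,
        eventually_mem_nhdsWithin.mono fun _ hz => mem_Ioi.2 (sub_pos.2 hz)⟩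
  filter_upwards [hslope.eventually_lt_const (sub_pos.2 hr), hshift.eventually hD,
    self_mem_nhdsWithin] with z hz hstep hsz
  have hpos : 0 < z - s := sub_pos.2 hsz
  have hsplit : x z = x s + (z - s) • D + ((z - s) • b + (z - s) • (slope x s z - (D + b))) := by
    rw [smul_sub, slope, vsub_eq_sub, smul_inv_smul₀ hpos.ne', smul_add]
    abel
  have hxz : p (x z) ≤ p (x s) + (z - s) * (p b + p (slope x s z - (D + b))) := by
    calc p (x z) ≤ p (x s + (z - s) • D) +
          (p ((z - s) • b) + p ((z - s) • (slope x s z - (D + b)))) := by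
          conv_lhs => rw [hsplit]
          exact (map_add_le_add p _ _).trans (by gcongr; exact map_add_le_add p _ _)
      _ ≤ p (x s) + (z - s) * (p b + p (slope x s z - (D + b))) := by
          rw [map_smul_eq_mul, map_smul_eq_mul, Real.norm_of_nonneg hpos.le, mul_add]
          gcongr
  rw [slope_def_field, div_lt_iff₀ hpos]
  nlinarith

lemma seminorm_le_add_mul_of_euler_step_le (hp : Continuous p) {x D b : ℝ → E} {B : ℝ}
    (hx : ∀ t, 0 ≤ t → HasDerivWithinAt x (D t + b t) (Ici 0) t)
    (hD : ∀ t, 0 ≤ t → ∀ᶠ h in 𝓝[>] (0 : ℝ), p (x t + h • D t) ≤ p (x t))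
    (hb : ∀ t, 0 ≤ t → p (b t) ≤ B) {t : ℝ} (ht : 0 ≤ t) : p (x t) ≤ p (x 0) + B * t := by
  refine image_le_of_liminf_slope_right_le_deriv_boundary (f := fun s => p (x s))
    (B := fun s => p (x 0) + B * s) (B' := fun _ => B) (a := 0) (b := t)
    (hp.comp_continuousOn fun s hs =>
      (hx s hs.1).continuousWithinAt.mono Icc_subset_Ici_self) (by simp) (by fun_prop)
    (fun s _ => ?_) (fun s hs r hr => ?_) ⟨ht, le_rfl⟩
  · simpa using ((hasDerivWithinAt_id s (Ici s)).const_mul B).const_add (p (x 0))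
  · exact (eventually_slope_lt_of_euler_step_le hp ((hx s hs.1).mono (Ioi_subset_Ici hs.1))
      (hD s hs.1) ((hb s hs.1).trans_lt hr)).frequently

end SeminormGrowth

section Upwind

/-- Translation by `a` on the bounded continuous functions of the plane. -/
noncomputable def shiftCLM (a : ℝ × ℝ) : (ℝ × ℝ →ᵇ ℝ) →L[ℝ] (ℝ × ℝ →ᵇ ℝ) :=
  LinearMap.mkContinuous
    { toFun := fun f => f.compContinuous ⟨fun p => p + a, by fun_prop⟩
      map_add' := fun _ _ => rfl
      map_smul' := fun _ _ => rfl }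
    1 fun f => by
      rw [one_mul]
      exact (BoundedContinuousFunction.norm_le (norm_nonneg _)).2 fun p => f.norm_coe_le_norm _

@[simp]
lemma shiftCLM_apply (a : ℝ × ℝ) (f : ℝ × ℝ →ᵇ ℝ) (p : ℝ × ℝ) : shiftCLM a f p = f (p + a) := rfl

lemma shiftCLM_eq_self_iff {a : ℝ × ℝ} {f : ℝ × ℝ →ᵇ ℝ} :
    shiftCLM a f = f ↔ Function.Periodic f a := DFunLike.ext_iff

lemma norm_shiftCLM_le (a : ℝ × ℝ) : ‖shiftCLM a‖ ≤ 1 :=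
  LinearMap.mkContinuous_norm_le _ zero_le_one _

/-- The four directions into which the scheme transports mass. -/
def upwindDir : Fin 4 → ℝ × ℝ := ![(1, 0), (-1, 0), (0, 1), (0, -1)]

/-- The speeds `u⁺`, `u⁻`, `v⁺`, `v⁻` of the transport in the directions `upwindDir`. -/
noncomputable def upwindWeight (u v : ℝ × ℝ →ᵇ ℝ) : Fin 4 → (ℝ × ℝ →ᵇ ℝ) :=
  ![0 ⊔ u, 0 ⊔ -u, 0 ⊔ v, 0 ⊔ -v]

lemma upwindWeight_apply (u v : ℝ × ℝ →ᵇ ℝ) (i : Fin 4) (p : ℝ × ℝ) :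
    upwindWeight u v i p = ![max 0 (u p), max 0 (-u p), max 0 (v p), max 0 (-v p)] i := by
  fin_cases i <;> rfl

lemma upwindWeight_nonneg (u v : ℝ × ℝ →ᵇ ℝ) (i : Fin 4) (p : ℝ × ℝ) :
    0 ≤ upwindWeight u v i p := by
  rw [upwindWeight_apply]
  fin_cases i <;> exact le_max_left _ _

lemma sum_upwindWeight (u v : ℝ × ℝ →ᵇ ℝ) (p : ℝ × ℝ) :
    ∑ i, upwindWeight u v i p = |u p| + |v p| := by
  have hparts : ∀ x : ℝ, max 0 x + max 0 (-x) = |x| := fun x => by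
    rw [max_comm, max_comm 0 (-x)]
    exact posPart_add_negPart x
  simp only [upwindWeight_apply, Fin.sum_univ_four]
  rw [← hparts, ← hparts, ← add_assoc]
  rfl

lemma norm_upwindWeight_le (u v : ℝ × ℝ →ᵇ ℝ) (i : Fin 4) : ‖upwindWeight u v i‖ ≤ ‖u‖ + ‖v‖ := by
  refine (BoundedContinuousFunction.norm_le (by positivity)).2 fun p => ?_
  rw [Real.norm_of_nonneg (upwindWeight_nonneg u v i p)]
  calc upwindWeight u v i p ≤ ∑ j, upwindWeight u v j p :=
        Finset.single_le_sum (f := fun j => upwindWeight u v j p)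
          (fun j _ => upwindWeight_nonneg u v j p) (Finset.mem_univ i)
    _ = |u p| + |v p| := sum_upwindWeight u v p
    _ ≤ ‖u‖ + ‖v‖ := add_le_add (u.norm_coe_le_norm p) (v.norm_coe_le_norm p)

lemma continuousOn_upwindWeight {u v : ℝ → (ℝ × ℝ →ᵇ ℝ)} {s : Set ℝ} (hu : ContinuousOn u s)
    (hv : ContinuousOn v s) (i : Fin 4) : ContinuousOn (fun t => upwindWeight (u t) (v t) i) s := by
  fin_cases i
  · exact continuousOn_const.sup hu
  · exact continuousOn_const.sup hu.neg
  · exact continuousOn_const.sup hv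
  · exact continuousOn_const.sup hv.neg

/-- The upwind discretization as a bounded operator on `C_b(ℝ²)`: the mass `X * upwindWeight u v i`
leaves each point and arrives at distance `ε` in the direction `upwindDir i`. -/
noncomputable def upwindCLM (ε : ℝ) (u v : ℝ × ℝ →ᵇ ℝ) : (ℝ × ℝ →ᵇ ℝ) →L[ℝ] (ℝ × ℝ →ᵇ ℝ) :=
  (1 / ε) • ∑ i, (shiftCLM (-(ε • upwindDir i)) - ContinuousLinearMap.id ℝ _) ∘L
    ContinuousLinearMap.mul ℝ (ℝ × ℝ →ᵇ ℝ) (upwindWeight u v i)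

lemma upwindCLM_apply (ε : ℝ) (u v X : ℝ × ℝ →ᵇ ℝ) (p : ℝ × ℝ) :
    upwindCLM ε u v X p = 1 / ε * ∑ i, ((X * upwindWeight u v i) (p + -(ε • upwindDir i)) -
      (X * upwindWeight u v i) p) := by
  simp [upwindCLM, mul_comm, BoundedContinuousFunction.coe_sum]

lemma upwindCLM_apply_eq_upwind (ε : ℝ) (u v X : ℝ × ℝ →ᵇ ℝ) (p : ℝ × ℝ) :
    upwindCLM ε u v X p = upwind ε u v X p := by
  rw [upwindCLM_apply, upwind, Finset.sum_sub_distrib]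
  simp only [BoundedContinuousFunction.coe_mul, Pi.mul_apply, ← Finset.mul_sum,
    sum_upwindWeight u v p]
  simp only [upwindWeight_apply, Fin.sum_univ_four]
  obtain ⟨x, y⟩ := p
  simp only [upwindDir, Matrix.cons_val_zero, Matrix.cons_val_one, Matrix.cons_val, Prod.smul_mk,
    Prod.neg_mk, Prod.mk_add_mk, smul_eq_mul, mul_one, mul_zero, mul_neg, neg_neg, neg_zero,
    add_zero, sub_eq_add_neg]
  ring

lemma norm_upwindCLM_le {ε : ℝ} (hε : 0 < ε) (u v : ℝ × ℝ →ᵇ ℝ) :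
    ‖upwindCLM ε u v‖ ≤ 1 / ε * (8 * (‖u‖ + ‖v‖)) := by
  have hdiff : ∀ i, ‖shiftCLM (-(ε • upwindDir i)) -
      ContinuousLinearMap.id ℝ (ℝ × ℝ →ᵇ ℝ)‖ ≤ 2 := fun i => by
    refine (norm_sub_le (shiftCLM _) (ContinuousLinearMap.id ℝ _)).trans ?_
    linarith [norm_shiftCLM_le (-(ε • upwindDir i)),
      ContinuousLinearMap.norm_id_le (𝕜 := ℝ) (E := ℝ × ℝ →ᵇ ℝ)]
  have hterm : ∀ i, ‖(shiftCLM (-(ε • upwindDir i)) - ContinuousLinearMap.id ℝ (ℝ × ℝ →ᵇ ℝ)) ∘L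
      ContinuousLinearMap.mul ℝ (ℝ × ℝ →ᵇ ℝ) (upwindWeight u v i)‖ ≤ 2 * (‖u‖ + ‖v‖) := fun i =>
    (ContinuousLinearMap.opNorm_comp_le _ _).trans <| mul_le_mul (hdiff i)
      ((ContinuousLinearMap.opNorm_mul_apply_le ℝ _ _).trans (norm_upwindWeight_le u v i))
      (norm_nonneg _) zero_le_two
  refine (ContinuousLinearMap.opNorm_smul_le _ _).trans ?_
  rw [Real.norm_of_nonneg (by positivity)]
  gcongr
  refine (norm_sum_le_of_le (f := fun i => (shiftCLM (-(ε • upwindDir i)) -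
    ContinuousLinearMap.id ℝ _) ∘L ContinuousLinearMap.mul ℝ (ℝ × ℝ →ᵇ ℝ) (upwindWeight u v i))
    (n := fun _ => 2 * (‖u‖ + ‖v‖)) _ fun i _ => hterm i).trans_eq ?_
  rw [Finset.sum_const, Finset.card_univ, Fintype.card_fin, nsmul_eq_mul]
  ring

lemma continuousOn_upwindCLM (ε : ℝ) {u v : ℝ → (ℝ × ℝ →ᵇ ℝ)} {s : Set ℝ}
    (hu : ContinuousOn u s) (hv : ContinuousOn v s) :
    ContinuousOn (fun t => upwindCLM ε (u t) (v t)) s := by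
  unfold upwindCLM
  exact (continuousOn_finsetSum _ fun i _ => continuousOn_const.clm_comp
    ((ContinuousLinearMap.mul ℝ _).continuous.comp_continuousOn
      (continuousOn_upwindWeight hu hv i))).const_smul (1 / ε)

lemma shiftCLM_upwindCLM (ε : ℝ) {u v : ℝ × ℝ →ᵇ ℝ} {a : ℝ × ℝ} (hu : Function.Periodic u a)
    (hv : Function.Periodic v a) (X : ℝ × ℝ →ᵇ ℝ) :
    shiftCLM a (upwindCLM ε u v X) = upwindCLM ε u v (shiftCLM a X) := by
  ext p
  simp only [shiftCLM_apply, upwindCLM_apply, BoundedContinuousFunction.coe_mul, Pi.mul_apply,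
    upwindWeight_apply, hu _, hv _, add_right_comm p a]

lemma upwindCLM_euler_step_nonneg {ε h : ℝ} (hε : 0 < ε) (hh : 0 ≤ h) {u v X : ℝ × ℝ →ᵇ ℝ}
    (hsmall : h / ε * (‖u‖ + ‖v‖) ≤ 1) (hX : 0 ≤ X) : 0 ≤ X + h • upwindCLM ε u v X := fun p => by
  have hout : h / ε * (|u p| + |v p|) ≤ 1 := hsmall.trans' <| by
    gcongr
    exacts [u.norm_coe_le_norm p, v.norm_coe_le_norm p]
  have hsplit : (X + h • upwindCLM ε u v X) p = (1 - h / ε * (|u p| + |v p|)) * X p +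
      h / ε * ∑ i, (X * upwindWeight u v i) (p + -(ε • upwindDir i)) := by
    rw [BoundedContinuousFunction.add_apply, BoundedContinuousFunction.smul_apply,
      upwindCLM_apply, Finset.sum_sub_distrib, smul_eq_mul, ← sum_upwindWeight]
    simp only [BoundedContinuousFunction.coe_mul, Pi.mul_apply, ← Finset.mul_sum]
    ring
  change 0 ≤ (X + h • upwindCLM ε u v X) p
  rw [hsplit]
  exact add_nonneg (mul_nonneg (sub_nonneg.2 hout) (hX p)) <| mul_nonneg (by positivity) <|
    Finset.sum_nonneg fun i _ => mul_nonneg (hX _) (upwindWeight_nonneg u v i _)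

lemma abs_upwindCLM_euler_step_le {ε h : ℝ} (hε : 0 < ε) (hh : 0 ≤ h) {u v : ℝ × ℝ →ᵇ ℝ}
    (hsmall : h / ε * (‖u‖ + ‖v‖) ≤ 1) (X : ℝ × ℝ →ᵇ ℝ) :
    |X + h • upwindCLM ε u v X| ≤ |X| + h • upwindCLM ε u v |X| := by
  have hpos := upwindCLM_euler_step_nonneg hε hh hsmall (sub_nonneg.2 (le_abs_self X))
  have hneg := upwindCLM_euler_step_nonneg hε hh hsmall
    (neg_le_iff_add_nonneg'.1 (neg_le_abs X))
  rw [map_sub, smul_sub] at hpos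
  rw [map_add, smul_add] at hneg
  refine abs_le'.2 ⟨sub_nonneg.1 (hpos.trans_eq (by abel)), ?_⟩
  exact neg_le_iff_add_nonneg.2 (hneg.trans_eq (by abel))

lemma IsTorusPeriodic.mul_upwindWeight {u v X : ℝ × ℝ →ᵇ ℝ} (hu : IsTorusPeriodic u)
    (hv : IsTorusPeriodic v) (hX : IsTorusPeriodic X) (i : Fin 4) :
    IsTorusPeriodic ⇑(X * upwindWeight u v i) :=
  hX.mul fun x y => by
    simp only [upwindWeight_apply, (hu x y).1, (hu x y).2, (hv x y).1, (hv x y).2, and_self]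

lemma integral_upwindCLM_eq_zero (ε : ℝ) {u v X : ℝ × ℝ →ᵇ ℝ} (hu : IsTorusPeriodic u)
    (hv : IsTorusPeriodic v) (hX : IsTorusPeriodic X) :
    ∫ p in torusBox, upwindCLM ε u v X p = 0 := by
  have hint : ∀ f : ℝ × ℝ →ᵇ ℝ, IntegrableOn f torusBox := fun f =>
    integrableOn_torusBox f.continuous
  have hshift : ∀ (f : ℝ × ℝ →ᵇ ℝ) a, IntegrableOn (fun p => f (p + a)) torusBox := fun f a =>
    hint (shiftCLM a f)
  simp_rw [upwindCLM_apply]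
  rw [integral_const_mul, integral_finsetSum (f := fun i p =>
    (X * upwindWeight u v i) (p + -(ε • upwindDir i)) - (X * upwindWeight u v i) p) _
    fun i _ => (hshift _ _).sub (hint _)]
  refine mul_eq_zero_of_right _ (Finset.sum_eq_zero fun i _ => ?_)
  rw [integral_sub (hshift _ _) (hint _),
    (hu.mul_upwindWeight hv hX i).integral_comp_add_right (X * upwindWeight u v i).continuous,
    sub_self]

lemma torusL1_upwindCLM_euler_step_le {ε h : ℝ} (hε : 0 < ε) (hh : 0 ≤ h) {u v X : ℝ × ℝ →ᵇ ℝ}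
    (hu : IsTorusPeriodic u) (hv : IsTorusPeriodic v) (hX : IsTorusPeriodic X)
    (hsmall : h / ε * (‖u‖ + ‖v‖) ≤ 1) :
    torusL1 ⇑(X + h • upwindCLM ε u v X) ≤ torusL1 X := by
  have hint : ∀ f : ℝ × ℝ →ᵇ ℝ, IntegrableOn f torusBox := fun f =>
    integrableOn_torusBox f.continuous
  calc torusL1 ⇑(X + h • upwindCLM ε u v X)
      ≤ ∫ p in torusBox, (|X| p + h * upwindCLM ε u v |X| p) :=
        setIntegral_mono (hint |X + h • upwindCLM ε u v X|) (hint (|X| + h • upwindCLM ε u v |X|))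
          fun p => abs_upwindCLM_euler_step_le hε hh hsmall X p
    _ = torusL1 X := by
        rw [integral_add (hint _) ((hint _).const_mul h), integral_const_mul,
          integral_upwindCLM_eq_zero ε hu hv (hX.comp abs), mul_zero, add_zero]
        rfl

end Upwind

section UpwindODE

/-- A path `[0, ∞) → C_b(ℝ²)` which is continuous, bounded and has periodic values. -/
structure IsBoundedTorusPath (b : ℝ → (ℝ × ℝ →ᵇ ℝ)) : Prop where
  continuousOn : ContinuousOn b (Ici 0)
  bounded : ∃ B, ∀ t, 0 ≤ t → ‖b t‖ ≤ B
  periodic : ∀ t, 0 ≤ t → IsTorusPeriodic (b t)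

lemma isBoundedTorusPath_zero : IsBoundedTorusPath 0 :=
  ⟨continuousOn_const, ⟨0, fun _ _ => norm_zero.le⟩, fun _ _ _ _ => ⟨rfl, rfl⟩⟩

lemma isUpwindSolution_iff {ε : ℝ} {u v b X : ℝ → (ℝ × ℝ →ᵇ ℝ)} {X₀ : ℝ × ℝ →ᵇ ℝ} :
    IsUpwindSolution ε u v (fun t => b t) X₀ X ↔ X 0 = X₀ ∧ ∀ t, 0 ≤ t →
      HasDerivWithinAt X (upwindCLM ε (u t) (v t) (X t) + b t) (Ici 0) t := by
  have happly : ∀ t p, (upwindCLM ε (u t) (v t) (X t) + b t) p =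
      upwind ε (u t) (v t) (X t) p + b t p := fun t p => by
    rw [BoundedContinuousFunction.add_apply, upwindCLM_apply_eq_upwind]
  refine and_congr_right fun _ => forall₂_congr fun t _ => ⟨?_, fun h => ⟨_, happly t, h⟩⟩
  rintro ⟨D, hD, h⟩
  rwa [DFunLike.ext D (upwindCLM ε (u t) (v t) (X t) + b t) fun p => by rw [hD, happly]] at h

lemma exists_lipschitzWith_upwindCLM_add {ε : ℝ} (hε : 0 < ε) {u v : ℝ → (ℝ × ℝ →ᵇ ℝ)}
    (hu : IsBoundedTorusPath u) (hv : IsBoundedTorusPath v) : ∃ K : NNReal,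
      ∀ t, 0 ≤ t → ∀ c, LipschitzWith K fun X => upwindCLM ε (u t) (v t) X + c := by
  obtain ⟨Mu, hMu⟩ := hu.bounded
  obtain ⟨Mv, hMv⟩ := hv.bounded
  refine ⟨(1 / ε * (8 * (Mu + Mv))).toNNReal, fun t ht c => ?_⟩
  refine LipschitzWith.of_dist_le' fun X Y => ?_
  rw [dist_add_right, dist_eq_norm, ← map_sub, dist_eq_norm]
  refine ContinuousLinearMap.le_of_opNorm_le _ ((norm_upwindCLM_le hε _ _).trans ?_) _
  gcongr
  exacts [hMu t ht, hMv t ht]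

lemma exists_isUpwindSolution {ε : ℝ} (hε : 0 < ε) {u v b : ℝ → (ℝ × ℝ →ᵇ ℝ)}
    (hu : IsBoundedTorusPath u) (hv : IsBoundedTorusPath v) (hb : IsBoundedTorusPath b)
    (X₀ : ℝ × ℝ →ᵇ ℝ) : ∃ X, IsUpwindSolution ε u v (fun t => b t) X₀ X := by
  obtain ⟨K, hK⟩ := exists_lipschitzWith_upwindCLM_add hε hu hv
  obtain ⟨B, hB⟩ := hb.bounded
  simp only [isUpwindSolution_iff]
  refine exists_hasDerivWithinAt_Ici_of_lipschitzWith
    (F := fun t X => upwindCLM ε (u t) (v t) X + b t) ?_ (fun t ht => hK t ht (b t))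
    (fun t ht => by simpa using hB t ht) X₀
  have hfst : MapsTo Prod.fst (Ici (0 : ℝ) ×ˢ univ) (Ici (0 : ℝ)) :=
    fun (z : ℝ × (ℝ × ℝ →ᵇ ℝ)) hz => hz.1
  exact (((continuousOn_upwindCLM ε hu.continuousOn hv.continuousOn).comp continuousOn_fst
    hfst).clm_apply continuousOn_snd).add (hb.continuousOn.comp continuousOn_fst hfst)

namespace IsUpwindSolution

variable {ε : ℝ} {u v b X : ℝ → (ℝ × ℝ →ᵇ ℝ)} {X₀ : ℝ × ℝ →ᵇ ℝ}

lemma hasDerivWithinAt (hX : IsUpwindSolution ε u v (fun t => b t) X₀ X) {t : ℝ} (ht : 0 ≤ t) :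
    HasDerivWithinAt X (upwindCLM ε (u t) (v t) (X t) + b t) (Ici 0) t :=
  (isUpwindSolution_iff.1 hX).2 t ht

lemma eq {Y : ℝ → (ℝ × ℝ →ᵇ ℝ)} (hε : 0 < ε) (hu : IsBoundedTorusPath u)
    (hv : IsBoundedTorusPath v) (hX : IsUpwindSolution ε u v (fun t => b t) X₀ X)
    (hY : IsUpwindSolution ε u v (fun t => b t) X₀ Y) {t : ℝ} (ht : 0 ≤ t) : Y t = X t := by
  obtain ⟨K, hK⟩ := exists_lipschitzWith_upwindCLM_add hε hu hv
  exact eq_of_hasDerivWithinAt_Ici_of_lipschitzWith (fun t ht => hK t ht (b t))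
    (fun t ht => hY.hasDerivWithinAt ht) (fun t ht => hX.hasDerivWithinAt ht)
    (hY.1.trans hX.1.symm) ht

lemma shiftCLM_comp {a : ℝ × ℝ} (hu : ∀ t, 0 ≤ t → Function.Periodic (u t) a)
    (hv : ∀ t, 0 ≤ t → Function.Periodic (v t) a) (hb : ∀ t, 0 ≤ t → Function.Periodic (b t) a)
    (h₀ : Function.Periodic X₀ a) (hX : IsUpwindSolution ε u v (fun t => b t) X₀ X) :
    IsUpwindSolution ε u v (fun t => b t) X₀ fun t => shiftCLM a (X t) := by
  refine isUpwindSolution_iff.2 ⟨by rw [hX.1, shiftCLM_eq_self_iff.2 h₀], fun t ht => ?_⟩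
  have hderiv := (shiftCLM a).hasFDerivAt.comp_hasDerivWithinAt t (hX.hasDerivWithinAt ht)
  rwa [map_add, shiftCLM_upwindCLM ε (hu t ht) (hv t ht), shiftCLM_eq_self_iff.2 (hb t ht)]
    at hderiv

lemma isTorusPeriodic (hε : 0 < ε) (hu : IsBoundedTorusPath u) (hv : IsBoundedTorusPath v)
    (hb : IsBoundedTorusPath b) (h₀ : IsTorusPeriodic X₀)
    (hX : IsUpwindSolution ε u v (fun t => b t) X₀ X) {t : ℝ} (ht : 0 ≤ t) :
    IsTorusPeriodic (X t) := by
  have hper : ∀ a, (∀ f, IsTorusPeriodic f → Function.Periodic f a) → Function.Periodic (X t) a :=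
    fun a ha => shiftCLM_eq_self_iff.1 <| hX.eq hε hu hv
      (hX.shiftCLM_comp (fun t ht => ha _ (hu.periodic t ht)) (fun t ht => ha _ (hv.periodic t ht))
        (fun t ht => ha _ (hb.periodic t ht)) (ha _ h₀)) ht
  exact IsTorusPeriodic.iff_periodic.2
    ⟨hper _ fun f hf => (IsTorusPeriodic.iff_periodic.1 hf).1,
      hper _ fun f hf => (IsTorusPeriodic.iff_periodic.1 hf).2⟩

lemma torusL1_le (hε : 0 < ε) (hu : IsBoundedTorusPath u) (hv : IsBoundedTorusPath v)
    (hb : IsBoundedTorusPath b) (h₀ : IsTorusPeriodic X₀)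
    (hX : IsUpwindSolution ε u v (fun t => b t) X₀ X) {B : ℝ}
    (hB : ∀ t, 0 ≤ t → torusL1 (b t) ≤ B) {t : ℝ} (ht : 0 ≤ t) :
    torusL1 (X t) ≤ torusL1 X₀ + B * t := by
  rw [← hX.1]
  refine seminorm_le_add_mul_of_euler_step_le continuous_torusSeminorm
    (fun t ht => hX.hasDerivWithinAt ht) (fun t ht => ?_) hB ht
  have hsmall : ∀ᶠ h in 𝓝[>] (0 : ℝ), h / ε * (‖u t‖ + ‖v t‖) < 1 := by
    have hlim : Tendsto (fun h => h / ε * (‖u t‖ + ‖v t‖)) (𝓝[>] 0)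
        (𝓝 (0 / ε * (‖u t‖ + ‖v t‖))) :=
      (Continuous.tendsto (by fun_prop) _).mono_left nhdsWithin_le_nhds
    exact hlim.eventually_lt_const (by simp)
  filter_upwards [hsmall, self_mem_nhdsWithin] with h hh hpos
  exact torusL1_upwindCLM_euler_step_le hε (le_of_lt hpos) (hu.periodic t ht) (hv.periodic t ht)
    (hX.isTorusPeriodic hε hu hv hb h₀ ht) hh.le

end IsUpwindSolution

end UpwindODE

section TestFunctions

lemma exists_abs_integral_le_mul_torusL1 (R : ℝ) : ∃ n : ℝ, 0 ≤ n ∧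
    ∀ (f g : ℝ × ℝ → ℝ) (c : ℝ), 0 ≤ c → IsTorusPeriodic g → LocallyIntegrable g →
      (∀ p, |f p| ≤ c * |g p|) → (∀ p, f p ≠ 0 → ‖p‖ ≤ R) →
      |∫ p, f p| ≤ c * (n * torusL1 g) := by
  obtain ⟨n, hn, hball⟩ := exists_setIntegral_closedBall_le_torusL1 R
  refine ⟨n, hn, fun f g c hc hg hgi hfg hf => ?_⟩
  have hfR : ∀ p, p ∉ Metric.closedBall (0 : ℝ × ℝ) R → f p = 0 := fun p hp =>
    not_imp_comm.1 (hf p) (mt mem_closedBall_zero_iff.2 hp)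
  calc |∫ p, f p| = |∫ p in Metric.closedBall 0 R, f p| := by
        rw [setIntegral_eq_integral_of_forall_compl_eq_zero hfR]
    _ ≤ ∫ p in Metric.closedBall 0 R, c * |g p| := abs_integral_le_of_abs_le
        ((hgi.integrableOn_isCompact (isCompact_closedBall _ _)).abs.const_mul c) hfg
    _ = c * ∫ p in Metric.closedBall 0 R, |g p| := integral_const_mul _ _
    _ ≤ c * (n * torusL1 g) := mul_le_mul_of_nonneg_left (hball g hg hgi 0) hc

namespace IsTestFunction

variable {ψ : ℝ × ℝ → ℝ}

lemma integrable_mul (hψ : IsTestFunction ψ) {f : ℝ × ℝ → ℝ} (hf : LocallyIntegrable f) :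
    Integrable fun p => f p * ψ p :=
  hf.integrable_smul_right_of_hasCompactSupport hψ.continuous hψ.2

lemma exists_abs_le (hψ : IsTestFunction ψ) : ∃ a : ℝ, 0 ≤ a ∧ ∀ p, |ψ p| ≤ a := by
  obtain ⟨a, ha⟩ := hψ.continuous.bounded_above_of_compact_support hψ.2
  exact ⟨a, (norm_nonneg _).trans (ha 0), ha⟩

lemma exists_lipschitzWith (hψ : IsTestFunction ψ) : ∃ Λ, LipschitzWith Λ ψ :=
  hψ.contDiff_one.lipschitzWith_of_hasCompactSupport hψ.2 one_ne_zero

lemma exists_abs_integral_mul_le (hψ : IsTestFunction ψ) : ∃ C : ℝ, 0 ≤ C ∧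
    ∀ g : ℝ × ℝ → ℝ, IsTorusPeriodic g → LocallyIntegrable g →
      |∫ p, g p * ψ p| ≤ C * torusL1 g := by
  obtain ⟨R, -, hR⟩ := exists_norm_le_of_hasCompactSupport hψ.2
  obtain ⟨a, ha0, ha⟩ := hψ.exists_abs_le
  obtain ⟨n, hn, hint⟩ := exists_abs_integral_le_mul_torusL1 R
  refine ⟨a * n, by positivity, fun g hg hgi => ?_⟩
  rw [mul_assoc]
  refine hint _ g a ha0 hg hgi (fun p => ?_) fun p hp => hR p (right_ne_zero_of_mul hp)
  rw [abs_mul, mul_comm]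
  exact mul_le_mul_of_nonneg_right (ha p) (abs_nonneg _)

lemma exists_abs_taylor_le (hψ : IsTestFunction ψ) : ∃ C : ℝ, 0 ≤ C ∧
    ∀ p e, |ψ (p + e) - ψ p - fderiv ℝ ψ p e| ≤ C * ‖e‖ ^ 2 := by
  obtain ⟨C, hC⟩ : ∃ C, LipschitzWith C (fderiv ℝ ψ) :=
    ContDiff.lipschitzWith_of_hasCompactSupport (hψ.2.fderiv ℝ)
      (hψ.1.fderiv_right (m := 1) (WithTop.coe_le_coe.2 le_top)) one_ne_zero
  refine ⟨C, C.2, fun p e => ?_⟩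
  have hmvt := (convex_closedBall p ‖e‖).norm_image_sub_le_of_norm_fderiv_le' (𝕜 := ℝ) (f := ψ)
    (φ := fderiv ℝ ψ p) (C := C * ‖e‖) (x := p) (y := p + e) (fun x _ => hψ.differentiable x)
    (fun x hx => (hC.norm_sub_le x p).trans
      (mul_le_mul_of_nonneg_left (mem_closedBall_iff_norm.1 hx) C.2))
    (Metric.mem_closedBall_self (norm_nonneg e)) (by simp [Metric.mem_closedBall])
  rwa [add_sub_cancel_left, Real.norm_eq_abs, mul_assoc, ← sq] at hmvt

lemma exists_abs_difference_sub_fderiv_le (hψ : IsTestFunction ψ) : ∃ C R : ℝ, 0 ≤ C ∧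
    ∀ ε : ℝ, 0 < ε → ε ≤ 1 → ∀ e : ℝ × ℝ, ‖e‖ ≤ 1 → ∀ p,
      |1 / ε * (ψ (p + ε • e) - ψ p) - fderiv ℝ ψ p e| ≤ C * ε ∧
        (1 / ε * (ψ (p + ε • e) - ψ p) - fderiv ℝ ψ p e ≠ 0 → ‖p‖ ≤ R) := by
  obtain ⟨C, hC0, hC⟩ := hψ.exists_abs_taylor_le
  obtain ⟨R, hR0, hR⟩ := exists_norm_le_of_hasCompactSupport hψ.2
  obtain ⟨R', hR'0, hR'⟩ := exists_norm_le_of_hasCompactSupport (hψ.2.fderiv ℝ)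
  refine ⟨C, R + 1 + R', hC0, fun ε hε hε1 e he p => ?_⟩
  have hεe : ‖ε • e‖ ≤ ε := by
    rw [norm_smul, Real.norm_of_nonneg hε.le]
    exact mul_le_of_le_one_right hε.le he
  constructor
  · have hscale : 1 / ε * (ψ (p + ε • e) - ψ p) - fderiv ℝ ψ p e =
        1 / ε * (ψ (p + ε • e) - ψ p - fderiv ℝ ψ p (ε • e)) := by
      rw [map_smul, smul_eq_mul]
      field_simp
    rw [hscale, abs_mul, abs_of_pos (by positivity : 0 < 1 / ε)]
    calc 1 / ε * |ψ (p + ε • e) - ψ p - fderiv ℝ ψ p (ε • e)| ≤ 1 / ε * (C * ε ^ 2) := by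
          gcongr
          exact (hC p _).trans (by gcongr)
      _ = C * ε := by field_simp
  · refine not_imp_comm.1 fun hp => ?_
    rw [not_le] at hp
    have hψ0 : ψ p = 0 := not_not.1 (mt (hR p) (by linarith))
    have hpe : ‖p‖ ≤ ‖p + ε • e‖ + ‖ε • e‖ := by
      simpa only [add_sub_cancel_right] using norm_sub_le (p + ε • e) (ε • e)
    have hψε : ψ (p + ε • e) = 0 := not_not.1 (mt (hR _) (by linarith))
    have hd : fderiv ℝ ψ p = 0 := not_not.1 (mt (hR' p) (by linarith))
    rw [hψ0, hψε, hd, sub_self, mul_zero, zero_apply, sub_zero]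

lemma integral_difference_mul (hψ : IsTestFunction ψ) {f : ℝ × ℝ → ℝ} (hf : Continuous f)
    (a : ℝ × ℝ) : ∫ p, (f (p + -a) - f p) * ψ p = ∫ p, f p * (ψ (p + a) - ψ p) := by
  have hshift : ∫ p, f (p + -a) * ψ p = ∫ p, f p * ψ (p + a) := by
    rw [← integral_add_right_eq_self _ a]
    simp only [add_neg_cancel_right]
  have hfψ := hψ.integrable_mul hf.locallyIntegrable
  have hfψa : Integrable fun p => f p * ψ (p + a) := by
    refine Continuous.integrable_of_hasCompactSupport (hf.mul ?_) ?_
    · exact hψ.continuous.comp (continuous_add_const a)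
    · exact (hψ.2.comp_homeomorph (Homeomorph.addRight a)).mul_left
  have hfaψ : Integrable fun p => f (p + -a) * ψ p :=
    hψ.integrable_mul (Continuous.locallyIntegrable (by fun_prop))
  simp only [sub_mul, mul_sub]
  rw [integral_sub hfaψ hfψ, integral_sub hfψa hfψ, hshift]

lemma exists_abs_integral_difference_sub_le (hψ : IsTestFunction ψ) : ∃ C : ℝ, 0 ≤ C ∧
    ∀ ε : ℝ, 0 < ε → ε ≤ 1 → ∀ e : ℝ × ℝ, ‖e‖ ≤ 1 → ∀ f : ℝ × ℝ → ℝ, IsTorusPeriodic f →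
      Continuous f → |∫ p, (1 / ε * (f (p + -(ε • e)) - f p) * ψ p - f p * fderiv ℝ ψ p e)| ≤
        C * ε * torusL1 f := by
  obtain ⟨C, R, hC0, hC⟩ := hψ.exists_abs_difference_sub_fderiv_le
  obtain ⟨n, hn, hint⟩ := exists_abs_integral_le_mul_torusL1 R
  refine ⟨C * n, by positivity, fun ε hε hε1 e he f hf hfc => ?_⟩
  have hparts : ∫ p, (1 / ε * (f (p + -(ε • e)) - f p) * ψ p - f p * fderiv ℝ ψ p e) =
      ∫ p, f p * (1 / ε * (ψ (p + ε • e) - ψ p) - fderiv ℝ ψ p e) := by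
    have hd := (hψ.fderiv_apply e).integrable_mul hfc.locallyIntegrable
    have hfdiff : Integrable fun p => (f (p + -(ε • e)) - f p) * ψ p :=
      hψ.integrable_mul (Continuous.locallyIntegrable (by fun_prop))
    have hψdiff : Integrable fun p => f p * (ψ (p + ε • e) - ψ p) :=
      Continuous.integrable_of_hasCompactSupport
        (hfc.mul ((hψ.continuous.comp (continuous_add_const _)).sub hψ.continuous))
        (((hψ.2.comp_homeomorph (Homeomorph.addRight (ε • e))).sub hψ.2).mul_left)
    simp only [mul_assoc, mul_sub (f _) (1 / ε * _), mul_left_comm (f _) (1 / ε)]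
    rw [integral_sub (hfdiff.const_mul _) hd, integral_sub (hψdiff.const_mul _) hd,
      integral_const_mul, integral_const_mul, hψ.integral_difference_mul hfc]
  rw [hparts]
  refine (hint _ f (C * ε) (by positivity) hf hfc.locallyIntegrable (fun p => ?_)
    fun p hp => (hC ε hε hε1 e he p).2 (right_ne_zero_of_mul hp)).trans_eq (by ring)
  rw [abs_mul, mul_comm]
  exact mul_le_mul_of_nonneg_right (hC ε hε hε1 e he p).1 (abs_nonneg _)

end IsTestFunction

end TestFunctions

section UpwindConsistency

/-- A translation invariant operator on `C_b(ℝ²)` with norm at most `κ` for the `L¹(𝕋²)` norm. The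
identity and the convolution operators are of this kind. -/
structure IsTorusMultiplier (κ : ℝ) (L : (ℝ × ℝ →ᵇ ℝ) →L[ℝ] (ℝ × ℝ →ᵇ ℝ)) : Prop where
  nonneg : 0 ≤ κ
  map_shiftCLM : ∀ a f, L (shiftCLM a f) = shiftCLM a (L f)
  torusL1_le : ∀ f : ℝ × ℝ →ᵇ ℝ, IsTorusPeriodic f → torusL1 (L f) ≤ κ * torusL1 f

lemma isTorusMultiplier_id : IsTorusMultiplier 1 (ContinuousLinearMap.id ℝ _) :=
  ⟨zero_le_one, fun _ _ => rfl, fun _ _ => (one_mul _).ge⟩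

lemma isTorusMultiplier_convCLM {k : ℝ × ℝ → ℝ} (hk : Continuous k) (hkc : HasCompactSupport k) :
    IsTorusMultiplier (∫ q, |k q|) (convCLM volume k hk hkc) where
  nonneg := integral_nonneg fun _ => abs_nonneg _
  map_shiftCLM a f := by
    ext p
    exact (realConv_add_const f k a p).symm
  torusL1_le f hf := (torusL1_realConv_le hf f.continuous hk hkc).trans_eq (mul_comm _ _)

namespace IsTorusMultiplier

variable {κ : ℝ} {L : (ℝ × ℝ →ᵇ ℝ) →L[ℝ] (ℝ × ℝ →ᵇ ℝ)}

lemma isTorusPeriodic (hL : IsTorusMultiplier κ L) {f : ℝ × ℝ →ᵇ ℝ} (hf : IsTorusPeriodic f) :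
    IsTorusPeriodic (L f) := by
  have hper : ∀ a, Function.Periodic f a → Function.Periodic (L f) a := fun a ha => by
    rw [← shiftCLM_eq_self_iff, ← hL.map_shiftCLM, shiftCLM_eq_self_iff.2 ha]
  rw [IsTorusPeriodic.iff_periodic] at hf ⊢
  exact hf.imp (hper _) (hper _)

lemma map_upwindCLM_apply (hL : IsTorusMultiplier κ L) (ε : ℝ) (u v X : ℝ × ℝ →ᵇ ℝ) (p : ℝ × ℝ) :
    L (upwindCLM ε u v X) p = ∑ i, 1 / ε * (L (X * upwindWeight u v i) (p + -(ε • upwindDir i)) -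
      L (X * upwindWeight u v i) p) := by
  have hX : upwindCLM ε u v X = (1 / ε) • ∑ i,
      (shiftCLM (-(ε • upwindDir i)) (X * upwindWeight u v i) - X * upwindWeight u v i) := by
    ext p
    simp [upwindCLM_apply, BoundedContinuousFunction.coe_sum]
  rw [← Finset.mul_sum, Finset.sum_sub_distrib]
  simp [hX, hL.map_shiftCLM, BoundedContinuousFunction.coe_sum]

end IsTorusMultiplier

lemma norm_upwindDir_le (i : Fin 4) : ‖upwindDir i‖ ≤ 1 := by
  fin_cases i <;> simp [upwindDir, Prod.norm_def]

lemma mul_eq_upwindWeight_sub (u v X : ℝ × ℝ →ᵇ ℝ) :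
    X * u = X * upwindWeight u v 0 - X * upwindWeight u v 1 ∧
      X * v = X * upwindWeight u v 2 - X * upwindWeight u v 3 := by
  have hparts : ∀ x : ℝ, x = max 0 x - max 0 (-x) := fun x => by
    rw [max_comm, max_comm 0 (-x)]
    exact (posPart_sub_negPart x).symm
  rw [← mul_sub, ← mul_sub]
  constructor <;> congr 1 <;> ext p <;> exact hparts _

lemma sum_map_upwindWeight_mul (L : (ℝ × ℝ →ᵇ ℝ) →L[ℝ] (ℝ × ℝ →ᵇ ℝ)) (u v X : ℝ × ℝ →ᵇ ℝ)
    (p : ℝ × ℝ) (T : ℝ × ℝ →L[ℝ] ℝ) : ∑ i, L (X * upwindWeight u v i) p * T (upwindDir i) =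
      L (X * u) p * T (1, 0) + L (X * v) p * T (0, 1) := by
  have hTx : T (-1, 0) = -T (1, 0) := by rw [← map_neg, Prod.neg_mk, neg_zero]
  have hTy : T (0, -1) = -T (0, 1) := by rw [← map_neg, Prod.neg_mk, neg_zero]
  rw [(mul_eq_upwindWeight_sub u v X).1, (mul_eq_upwindWeight_sub u v X).2, map_sub, map_sub,
    Fin.sum_univ_four]
  simp only [upwindDir, Matrix.cons_val, hTx, hTy, BoundedContinuousFunction.sub_apply]
  ring

lemma torusL1_mul_le (X f : ℝ × ℝ →ᵇ ℝ) : torusL1 ⇑(X * f) ≤ ‖f‖ * torusL1 X := by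
  calc torusL1 ⇑(X * f) ≤ torusL1 fun p => ‖f‖ * X p :=
        torusL1_mono (X * f).continuous (by fun_prop) fun p => by
          rw [BoundedContinuousFunction.coe_mul, Pi.mul_apply, abs_mul, abs_mul, abs_norm, mul_comm]
          exact mul_le_mul_of_nonneg_right (f.norm_coe_le_norm p) (abs_nonneg _)
    _ = ‖f‖ * torusL1 X := by rw [torusL1_const_mul, abs_norm]

lemma IsTestFunction.exists_abs_integral_map_upwindCLM_sub_le {ψ : ℝ × ℝ → ℝ}
    (hψ : IsTestFunction ψ) : ∃ C : ℝ, 0 ≤ C ∧ ∀ κ L, IsTorusMultiplier κ L →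
      ∀ ε : ℝ, 0 < ε → ε ≤ 1 → ∀ u v X : ℝ × ℝ →ᵇ ℝ, IsTorusPeriodic u → IsTorusPeriodic v →
      IsTorusPeriodic X → |∫ p, (L (upwindCLM ε u v X) p * ψ p - L (X * u) p * _root_.partialX ψ p -
        L (X * v) p * _root_.partialY ψ p)| ≤ C * κ * torusL1 X * ((‖u‖ + ‖v‖) * ε) := by
  obtain ⟨C, hC0, hC⟩ := hψ.exists_abs_integral_difference_sub_le
  refine ⟨4 * C, by positivity, fun κ L hL ε hε hε1 u v X hu hv hX => ?_⟩
  have hG := fun i => hL.isTorusPeriodic (hu.mul_upwindWeight hv hX i)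
  have hGL1 : ∀ i, torusL1 (L (X * upwindWeight u v i)) ≤ κ * ((‖u‖ + ‖v‖) * torusL1 X) :=
    fun i => (hL.torusL1_le _ (hu.mul_upwindWeight hv hX i)).trans <|
      mul_le_mul_of_nonneg_left ((torusL1_mul_le _ _).trans <| mul_le_mul_of_nonneg_right
        (norm_upwindWeight_le u v i) (torusL1_nonneg _)) hL.nonneg
  have hsplit : ∀ p, L (upwindCLM ε u v X) p * ψ p - L (X * u) p * _root_.partialX ψ p -
      L (X * v) p * _root_.partialY ψ p = ∑ i, (1 / ε *
        (L (X * upwindWeight u v i) (p + -(ε • upwindDir i)) - L (X * upwindWeight u v i) p) *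
          ψ p - L (X * upwindWeight u v i) p * fderiv ℝ ψ p (upwindDir i)) := fun p => by
    rw [hψ.partialX_eq, hψ.partialY_eq, sub_sub, ← sum_map_upwindWeight_mul,
      hL.map_upwindCLM_apply, Finset.sum_sub_distrib, Finset.sum_mul]
  simp_rw [hsplit]
  rw [integral_finsetSum _ fun i _ => ?_]
  · calc _ ≤ ∑ _ : Fin 4, C * ε * (κ * ((‖u‖ + ‖v‖) * torusL1 X)) :=
          (Finset.abs_sum_le_sum_abs _ _).trans <| Finset.sum_le_sum fun i _ =>
            (hC ε hε hε1 _ (norm_upwindDir_le i) _ (hG i) (BoundedContinuousFunction.continuous _)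
              ).trans <| mul_le_mul_of_nonneg_left (hGL1 i) (by positivity)
      _ = 4 * C * κ * torusL1 X * ((‖u‖ + ‖v‖) * ε) := by
          rw [Finset.sum_const, Finset.card_univ, Fintype.card_fin, nsmul_eq_mul]
          ring
  · exact (hψ.integrable_mul (Continuous.locallyIntegrable (by fun_prop))).sub
      ((hψ.fderiv_apply _).integrable_mul
        (BoundedContinuousFunction.continuous _).locallyIntegrable)

end UpwindConsistency

section Mollification

variable {f g k : ℝ × ℝ → ℝ} {Λ : NNReal} {r : ℝ}

lemma torusL1_realConv_abs_le (hp : IsTorusPeriodic f) (hf : Continuous f) (hk : Continuous k)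
    (hkc : HasCompactSupport k) :
    torusL1 (realConv (fun q => |f q|) (fun q => |k q|) volume) ≤ torusL1 f * ∫ q, |k q| := by
  simpa only [torusL1, abs_abs] using
    torusL1_realConv_le (hp.comp abs) hf.abs hk.abs (hkc.comp_left abs_zero)

lemma torusL1_realConv_mul_sub_le (hp : IsTorusPeriodic f) (hf : Continuous f)
    (hg : LipschitzWith Λ g) (hk : Continuous k) (hkc : HasCompactSupport k) (hr₀ : 0 ≤ r)
    (hr : ∀ p, k p ≠ 0 → ‖p‖ ≤ r) :
    torusL1 (fun p => realConv (fun q => f q * g q) k volume p - g p * realConv f k volume p) ≤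
      Λ * r * (torusL1 f * ∫ q, |k q|) := by
  calc _ ≤ torusL1 fun p => Λ * r * realConv (fun q => |f q|) (fun q => |k q|) volume p :=
        torusL1_mono ((continuous_realConv (hf.mul hg.continuous) hk hkc).sub
            (hg.continuous.mul (continuous_realConv hf hk hkc)))
          ((continuous_realConv hf.abs hk.abs (hkc.comp_left abs_zero)).const_mul _)
          fun p => (abs_realConv_mul_sub_le hf hg hk hkc hr p).trans (le_abs_self _)
    _ ≤ Λ * r * (torusL1 f * ∫ q, |k q|) := by
        rw [torusL1_const_mul, abs_of_nonneg (by positivity)]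
        gcongr
        exact torusL1_realConv_abs_le hp hf hk hkc

namespace IsTestFunction

variable {ψ : ℝ × ℝ → ℝ}

lemma exists_abs_integral_commutator_mul_le (hψ : IsTestFunction ψ) : ∃ C : ℝ, 0 ≤ C ∧
    ∀ {f k : ℝ × ℝ → ℝ}, IsTorusPeriodic f → Continuous f → Continuous k → HasCompactSupport k →
      ∀ {r : ℝ}, 0 ≤ r → (∀ p, k p ≠ 0 → ‖p‖ ≤ r) → ∀ {Λ : NNReal} {g : ℝ × ℝ → ℝ},
      IsTorusPeriodic g → LipschitzWith Λ g →
      |∫ p, (realConv (fun q => f q * g q) k volume p - g p * realConv f k volume p) * ψ p| ≤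
        C * ((∫ q, |k q|) * torusL1 f * (Λ * r)) := by
  obtain ⟨C, hC₀, hC⟩ := hψ.exists_abs_integral_mul_le
  refine ⟨C, hC₀, fun {f k} hf hfc hk hkc r hr₀ hr Λ g hg hΛ => ?_⟩
  refine (hC _ (((hf.mul hg).realConv k).sub (hg.mul (hf.realConv k))) ?_).trans ?_
  · exact ((continuous_realConv (hfc.mul hΛ.continuous) hk hkc).sub
      (hΛ.continuous.mul (continuous_realConv hfc hk hkc))).locallyIntegrable
  · rw [mul_comm (∫ q, |k q|), mul_comm _ ((Λ : ℝ) * r)]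
    exact mul_le_mul_of_nonneg_left (torusL1_realConv_mul_sub_le hf hfc hΛ hk hkc hr₀ hr) hC₀

lemma exists_abs_integral_convCLM_upwindCLM_sub_le (hψ : IsTestFunction ψ) : ∃ C : ℝ, 0 ≤ C ∧
    ∀ {k} (hk : Continuous k) (hkc : HasCompactSupport k) {r : ℝ}, 0 ≤ r →
      (∀ p, k p ≠ 0 → ‖p‖ ≤ r) → ∀ {ε : ℝ}, 0 < ε → ε ≤ 1 → ∀ {Λ : NNReal}
      {u v X : ℝ × ℝ →ᵇ ℝ}, IsTorusPeriodic u → IsTorusPeriodic v → IsTorusPeriodic X →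
      LipschitzWith Λ u → LipschitzWith Λ v →
      |∫ p, (convCLM volume k hk hkc (upwindCLM ε u v X) p * ψ p -
        u p * realConv X k volume p * _root_.partialX ψ p -
        v p * realConv X k volume p * _root_.partialY ψ p)| ≤
      C * ((∫ q, |k q|) * torusL1 X * ((‖u‖ + ‖v‖) * ε + Λ * r)) := by
  obtain ⟨C, hC₀, hC⟩ := hψ.exists_abs_integral_map_upwindCLM_sub_le
  obtain ⟨Cx, hCx₀, hCx⟩ := hψ.partialX.exists_abs_integral_commutator_mul_le
  obtain ⟨Cy, hCy₀, hCy⟩ := hψ.partialY.exists_abs_integral_commutator_mul_le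
  refine ⟨C + (Cx + Cy), by positivity,
    fun {k} hk hkc r hr₀ hr ε hε hε1 Λ u v X hu hv hX hΛu hΛv => ?_⟩
  set L := convCLM volume k hk hkc
  set κ := ∫ q, |k q|
  have hL : IsTorusMultiplier κ L := isTorusMultiplier_convCLM hk hkc
  have hx : Integrable fun p => (L (X * u) p - u p * L X p) * _root_.partialX ψ p :=
    hψ.partialX.integrable_mul (Continuous.locallyIntegrable (by fun_prop))
  have hy : Integrable fun p => (L (X * v) p - v p * L X p) * _root_.partialY ψ p :=
    hψ.partialY.integrable_mul (Continuous.locallyIntegrable (by fun_prop))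
  have hA : Integrable fun p => L (upwindCLM ε u v X) p * ψ p -
      L (X * u) p * _root_.partialX ψ p - L (X * v) p * _root_.partialY ψ p :=
    ((hψ.integrable_mul (Continuous.locallyIntegrable (by fun_prop))).sub
      (hψ.partialX.integrable_mul (Continuous.locallyIntegrable (by fun_prop)))).sub
      (hψ.partialY.integrable_mul (Continuous.locallyIntegrable (by fun_prop)))
  calc _ = |(∫ p, (L (upwindCLM ε u v X) p * ψ p - L (X * u) p * _root_.partialX ψ p -
          L (X * v) p * _root_.partialY ψ p)) +
        ((∫ p, (L (X * u) p - u p * L X p) * _root_.partialX ψ p) +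
          ∫ p, (L (X * v) p - v p * L X p) * _root_.partialY ψ p)| := by
        rw [← integral_add hx hy, ← integral_add hA (g := fun p => (L (X * u) p - u p * L X p) *
          _root_.partialX ψ p + (L (X * v) p - v p * L X p) * _root_.partialY ψ p) (hx.add hy)]
        congr 2 with p
        rw [← convCLM_apply hk hkc]
        ring
    _ ≤ C * κ * torusL1 X * ((‖u‖ + ‖v‖) * ε) +
        (Cx * (κ * torusL1 X * (Λ * r)) + Cy * (κ * torusL1 X * (Λ * r))) :=
      (abs_add_le _ _).trans <| add_le_add (hC κ L hL ε hε hε1 u v X hu hv hX) <|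
        (abs_add_le _ _).trans <| add_le_add
          (hCx hX X.continuous hk hkc hr₀ hr hu hΛu) (hCy hX X.continuous hk hkc hr₀ hr hv hΛv)
    _ ≤ (C + (Cx + Cy)) * (κ * torusL1 X * ((‖u‖ + ‖v‖) * ε + Λ * r)) := by
        have hX₀ := torusL1_nonneg X
        have hcross : 0 ≤ C * (κ * torusL1 X * (Λ * r)) +
          (Cx + Cy) * (κ * torusL1 X * ((‖u‖ + ‖v‖) * ε)) := by positivity
        linarith

end IsTestFunction

lemma norm_le_of_realConv_ne_zero {R : ℝ} (hf : ∀ p, f p ≠ 0 → ‖p‖ ≤ R)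
    (hk : ∀ p, k p ≠ 0 → ‖p‖ ≤ r) {p : ℝ × ℝ} (hp : realConv f k volume p ≠ 0) :
    ‖p‖ ≤ R + r := by
  obtain ⟨q, hq⟩ : ∃ q, f q * k (p - q) ≠ 0 := by
    by_contra! hzero
    exact hp (by rw [realConv_apply, funext hzero, integral_zero])
  calc ‖p‖ = ‖q + (p - q)‖ := by rw [add_sub_cancel]
    _ ≤ R + r := norm_add_le_of_le (hf q (left_ne_zero_of_mul hq)) (hk _ (right_ne_zero_of_mul hq))

lemma IsTestFunction.exists_abs_integral_realConv_mul_sub_le {ψ : ℝ × ℝ → ℝ}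
    (hψ : IsTestFunction ψ) (r₀ : ℝ) : ∃ C : ℝ, 0 ≤ C ∧
    ∀ {k : ℝ × ℝ → ℝ}, Continuous k → HasCompactSupport k → ∀ {r : ℝ}, 0 ≤ r → r ≤ r₀ →
      (∀ p, k p ≠ 0 → ‖p‖ ≤ r) → ∀ {f : ℝ × ℝ → ℝ}, IsTorusPeriodic f → Continuous f →
      |(∫ p, realConv f k volume p * ψ p) - (∫ p, k p) * ∫ p, f p * ψ p| ≤
        C * ((∫ q, |k q|) * torusL1 f * r) := by
  obtain ⟨Λ, hΛ⟩ := hψ.exists_lipschitzWith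
  obtain ⟨R, -, hR⟩ := exists_norm_le_of_hasCompactSupport hψ.2
  obtain ⟨n, hn, hint⟩ := exists_abs_integral_le_mul_torusL1 (R + r₀)
  refine ⟨Λ * n, by positivity, fun {k} hk hkc r hr₀ hrr₀ hr f hf hfc => ?_⟩
  have hfψ : Integrable fun p => f p * ψ p := hψ.integrable_mul hfc.locallyIntegrable
  have hki : Integrable k := hk.integrable_of_hasCompactSupport hkc
  have hconv : ∫ p, realConv (fun q => f q * ψ q) k volume p = (∫ p, k p) * ∫ p, f p * ψ p :=
    (integral_convolution (ContinuousLinearMap.mul ℝ ℝ) hfψ hki).trans (mul_comm _ _)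
  have hconvψ : Integrable fun p => realConv f k volume p * ψ p :=
    hψ.integrable_mul (continuous_realConv hfc hk hkc).locallyIntegrable
  rw [← hconv, abs_sub_comm, ← integral_sub (hfψ.integrable_convolution _ hki) hconvψ]
  calc _ ≤ Λ * r * (n * torusL1 (realConv (fun q => |f q|) (fun q => |k q|) volume)) := by
        refine hint _ _ _ (by positivity) ((hf.comp abs).realConv _) (continuous_realConv hfc.abs
          hk.abs (hkc.comp_left abs_zero)).locallyIntegrable (fun p => ?_) fun p => ?_
        · rw [mul_comm _ (ψ p)]
          exact (abs_realConv_mul_sub_le hfc hΛ hk hkc hr p).trans (by gcongr; exact le_abs_self _)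
        · contrapose!
          intro hp
          have hψp : ψ p = 0 := not_not.1 (mt (hR p) (by linarith))
          have hconvp : realConv (fun q => f q * ψ q) k volume p = 0 := not_not.1 <|
            mt (norm_le_of_realConv_ne_zero (fun q hq => hR q (right_ne_zero_of_mul hq)) hr)
              (by linarith)
          rw [hψp, mul_zero, sub_zero]
          exact hconvp
    _ ≤ Λ * r * (n * (torusL1 f * ∫ q, |k q|)) := by
        gcongr
        exact torusL1_realConv_abs_le hf hfc hk hkc
    _ = Λ * n * ((∫ q, |k q|) * torusL1 f * r) := by ring

end Mollification

section ScaledMollification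

variable {f φ : ℝ × ℝ → ℝ} {h : ℝ}

lemma realConv_const_mul (c : ℝ) (f k : ℝ × ℝ → ℝ) :
    realConv f (fun q => c * k q) volume = fun p => c * realConv f k volume p :=
  convolution_smul

lemma partialX_realConv_scaledKernel (hf : Continuous f) (hφ : IsTestFunction φ) (hh : h ≠ 0) :
    partialX (realConv f (scaledKernel φ h) volume) =
      fun p => 1 / h * realConv f (scaledKernel (partialX φ) h) volume p := by
  rw [partialX_realConv hf (isTestFunction_scaledKernel hφ hh), partialX_scaledKernel hφ hh,
    realConv_const_mul]

lemma partialY_realConv_scaledKernel (hf : Continuous f) (hφ : IsTestFunction φ) (hh : h ≠ 0) :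
    partialY (realConv f (scaledKernel φ h) volume) =
      fun p => 1 / h * realConv f (scaledKernel (partialY φ) h) volume p := by
  rw [partialY_realConv hf (isTestFunction_scaledKernel hφ hh), partialY_scaledKernel hφ hh,
    realConv_const_mul]

lemma exists_abs_realConv_scaledKernel_and_partial_le (hφ : IsTestFunction φ) :
    ∃ C : ℝ, 0 ≤ C ∧ ∀ h : ℝ, 0 < h → h ≤ 1 → ∀ f : ℝ × ℝ → ℝ, IsTorusPeriodic f →
      Continuous f → ∀ p, |realConv f (scaledKernel φ h) volume p| ≤ C * torusL1 f / h ^ 2 ∧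
        |partialX (realConv f (scaledKernel φ h) volume) p| ≤ C * torusL1 f / h ^ 3 ∧
        |partialY (realConv f (scaledKernel φ h) volume) p| ≤ C * torusL1 f / h ^ 3 := by
  obtain ⟨C₀, hC₀, hφ₀⟩ := exists_abs_realConv_scaledKernel_le hφ.continuous hφ.2
  obtain ⟨C₁, hC₁, hφ₁⟩ := exists_abs_realConv_scaledKernel_le hφ.partialX.continuous hφ.partialX.2
  obtain ⟨C₂, hC₂, hφ₂⟩ := exists_abs_realConv_scaledKernel_le hφ.partialY.continuous hφ.partialY.2
  refine ⟨C₀ + C₁ + C₂, by positivity, fun h hh hh₁ f hp hf p => ?_⟩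
  have hL₁ := torusL1_nonneg f
  have hscale : ∀ {c b : ℝ}, c ≤ C₀ + C₁ + C₂ → |b| ≤ c * torusL1 f / h ^ 2 →
      |1 / h * b| ≤ (C₀ + C₁ + C₂) * torusL1 f / h ^ 3 := fun {c b} hc hb => by
    rw [abs_mul, abs_of_pos (one_div_pos.2 hh)]
    calc 1 / h * |b| ≤ 1 / h * ((C₀ + C₁ + C₂) * torusL1 f / h ^ 2) := by
          gcongr
          exact hb.trans (by gcongr)
      _ = (C₀ + C₁ + C₂) * torusL1 f / h ^ 3 := by field_simp
  rw [partialX_realConv_scaledKernel hf hφ hh.ne', partialY_realConv_scaledKernel hf hφ hh.ne']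
  exact ⟨(hφ₀ h hh hh₁ f hp hf p).trans (by gcongr; linarith),
    hscale (by linarith) (hφ₁ h hh hh₁ f hp hf p), hscale (by linarith) (hφ₂ h hh hh₁ f hp hf p)⟩

namespace IsTestFunction

variable {ψ : ℝ × ℝ → ℝ}

lemma exists_abs_integral_convCLM_scaledKernel_upwindCLM_sub_le (hψ : IsTestFunction ψ)
    (hφ : IsTestFunction φ) : ∃ C : ℝ, 0 ≤ C ∧
    ∀ {h : ℝ} (hh : 0 < h) {ε : ℝ}, 0 < ε → ε ≤ 1 → ∀ {Λ : NNReal} {u v X : ℝ × ℝ →ᵇ ℝ},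
      IsTorusPeriodic u → IsTorusPeriodic v → IsTorusPeriodic X →
      LipschitzWith Λ u → LipschitzWith Λ v →
      |∫ p, (convCLM volume (scaledKernel φ h) (continuous_scaledKernel hφ.continuous h)
            (hasCompactSupport_scaledKernel hφ.2 hh.ne') (upwindCLM ε u v X) p * ψ p -
          u p * realConv X (scaledKernel φ h) volume p * _root_.partialX ψ p -
          v p * realConv X (scaledKernel φ h) volume p * _root_.partialY ψ p)| ≤
        C * torusL1 X * ((‖u‖ + ‖v‖) * ε + Λ * h) := by
  obtain ⟨C, hC₀, hC⟩ := hψ.exists_abs_integral_convCLM_upwindCLM_sub_le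
  obtain ⟨R, hR₀, hR⟩ := exists_norm_le_of_hasCompactSupport hφ.2
  refine ⟨C * (∫ q, |φ q|) * (1 + R), by positivity,
    fun {h} hh {ε} hε hε₁ {Λ u v X} hu hv hX hΛu hΛv => ?_⟩
  refine (hC (continuous_scaledKernel hφ.continuous h) (hasCompactSupport_scaledKernel hφ.2 hh.ne')
    (by positivity) (fun p => norm_le_of_scaledKernel_ne_zero hR hh) hε hε₁ hu hv hX
    hΛu hΛv).trans ?_
  rw [integral_abs_scaledKernel φ hh.ne']
  have hX₀ := torusL1_nonneg X
  calc _ = C * (∫ q, |φ q|) * torusL1 X * ((‖u‖ + ‖v‖) * ε + R * (Λ * h)) := by ring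
    _ ≤ C * (∫ q, |φ q|) * torusL1 X * ((1 + R) * ((‖u‖ + ‖v‖) * ε + Λ * h)) := by
        gcongr
        have hu₀ : 0 ≤ R * ((‖u‖ + ‖v‖) * ε) := by positivity
        have hΛ₀ : 0 ≤ Λ * h := by positivity
        linarith
    _ = _ := by ring

lemma exists_abs_integral_realConv_scaledKernel_mul_sub_le (hψ : IsTestFunction ψ)
    (hφ : Continuous φ) (hφc : HasCompactSupport φ) : ∃ C : ℝ, 0 ≤ C ∧
    ∀ h : ℝ, 0 < h → h ≤ 1 → ∀ f : ℝ × ℝ → ℝ, IsTorusPeriodic f → Continuous f →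
      |(∫ p, realConv f (scaledKernel φ h) volume p * ψ p) - (∫ p, φ p) * ∫ p, f p * ψ p| ≤
        C * torusL1 f * h := by
  obtain ⟨R, hR₀, hR⟩ := exists_norm_le_of_hasCompactSupport hφc
  obtain ⟨C, hC₀, hC⟩ := hψ.exists_abs_integral_realConv_mul_sub_le R
  refine ⟨C * (∫ q, |φ q|) * R, by positivity, fun h hh hh₁ f hf hfc => ?_⟩
  have herr := hC (continuous_scaledKernel hφ h) (hasCompactSupport_scaledKernel hφc hh.ne')
    (by positivity) (mul_le_of_le_one_right hR₀ hh₁)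
    (fun p => norm_le_of_scaledKernel_ne_zero hR hh) hf hfc
  rw [integral_scaledKernel φ hh.ne', integral_abs_scaledKernel φ hh.ne'] at herr
  exact herr.trans_eq (by ring)

end IsTestFunction

end ScaledMollification

lemma lipschitzWith_of_abs_partial_le {f : ℝ × ℝ → ℝ} {c : ℝ}
    (hd : ∀ p : ℝ × ℝ, DifferentiableAt ℝ (fun s => f (s, p.2)) p.1 ∧
      DifferentiableAt ℝ (fun s => f (p.1, s)) p.2)
    (hb : ∀ p, |partialX f p| ≤ c ∧ |partialY f p| ≤ c) :
    LipschitzWith (2 * c).toNNReal f := by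
  refine LipschitzWith.of_dist_le' fun p q => ?_
  have hc : 0 ≤ c := (abs_nonneg _).trans (hb p).1
  have hx : |f (p.1, p.2) - f (q.1, p.2)| ≤ c * |p.1 - q.1| :=
    convex_univ.norm_image_sub_le_of_norm_deriv_le (f := fun s => f (s, p.2))
      (fun s _ => (hd (s, p.2)).1) (fun s _ => (hb (s, p.2)).1) (mem_univ _) (mem_univ _)
  have hy : |f (q.1, p.2) - f (q.1, q.2)| ≤ c * |p.2 - q.2| :=
    convex_univ.norm_image_sub_le_of_norm_deriv_le (f := fun s => f (q.1, s))
      (fun s _ => (hd (q.1, s)).2) (fun s _ => (hb (q.1, s)).2) (mem_univ _) (mem_univ _)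
  calc dist (f p) (f q) ≤ c * |p.1 - q.1| + c * |p.2 - q.2| :=
        (abs_sub_le _ (f (q.1, p.2)) _).trans (add_le_add hx hy)
    _ ≤ c * ‖p - q‖ + c * ‖p - q‖ := by
        gcongr
        exacts [norm_fst_le (p - q), norm_snd_le (p - q)]
    _ = 2 * c * dist p q := by rw [dist_eq_norm]; ring

section Pressure

lemma exists_abs_eval_le (P : Polynomial ℝ) : ∃ c : ℝ, 0 ≤ c ∧ ∀ R : ℝ, 1 ≤ R → ∀ r : ℝ,
    |r| ≤ R → |P.eval r| ≤ c * R ^ P.natDegree := by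
  refine ⟨∑ i ∈ Finset.range (P.natDegree + 1), |P.coeff i|,
    Finset.sum_nonneg fun _ _ => abs_nonneg _, fun R hR r hr => ?_⟩
  rw [Polynomial.eval_eq_sum_range, Finset.sum_mul]
  refine (Finset.abs_sum_le_sum_abs _ _).trans (Finset.sum_le_sum fun i hi => ?_)
  rw [abs_mul, abs_pow]
  gcongr
  calc |r| ^ i ≤ R ^ i := by gcongr
    _ ≤ R ^ P.natDegree := pow_le_pow_right₀ hR (Nat.lt_succ_iff.1 (Finset.mem_range.1 hi))

lemma exists_abs_eval_mul_add_eval_mul_le (P Q : Polynomial ℝ) : ∃ c : ℝ, 0 ≤ c ∧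
    ∀ {R R' r x y : ℝ}, 1 ≤ R → |r| ≤ R → |x| ≤ R' → |y| ≤ R' →
      |-(P.eval r * x) - Q.eval r * y| ≤ c * R ^ (P.natDegree + Q.natDegree) * R' := by
  obtain ⟨c, hc, hP⟩ := exists_abs_eval_le P
  obtain ⟨d, hd, hQ⟩ := exists_abs_eval_le Q
  refine ⟨c + d, by positivity, fun {R R' r x y} hR hr hx hy => ?_⟩
  calc |-(P.eval r * x) - Q.eval r * y| ≤ |P.eval r| * |x| + |Q.eval r| * |y| := by
        simpa only [abs_neg, abs_mul] using abs_sub (-(P.eval r * x)) (Q.eval r * y)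
    _ ≤ c * R ^ P.natDegree * R' + d * R ^ Q.natDegree * R' := by
        gcongr
        exacts [hP R hR r hr, hQ R hR r hr]
    _ ≤ c * R ^ (P.natDegree + Q.natDegree) * R' + d * R ^ (P.natDegree + Q.natDegree) * R' := by
        have hR' : 0 ≤ R' := (abs_nonneg x).trans hx
        gcongr
        exacts [Nat.le_add_right _ _, Nat.le_add_left _ _]
    _ = (c + d) * R ^ (P.natDegree + Q.natDegree) * R' := by ring

lemma aeval_boundedContinuousFunction_apply {T : Type*} [TopologicalSpace T] (P : Polynomial ℝ)
    (r : T →ᵇ ℝ) (p : T) : Polynomial.aeval r P p = P.eval (r p) := by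
  induction P using Polynomial.induction_on' with
  | add P Q hP hQ => rw [map_add, BoundedContinuousFunction.add_apply, hP, hQ, Polynomial.eval_add]
  | monomial n a => simp [Polynomial.aeval_monomial]

variable {k : ℝ × ℝ → ℝ}

/-- The source `-P'(ρ) ∂ₓρ - Q'(ρ) ∂_yρ` for `ρ = X * k`, as a bounded continuous function. -/
noncomputable def pressureField (P Q : Polynomial ℝ) (hk : IsTestFunction k) (X : ℝ × ℝ →ᵇ ℝ) :
    ℝ × ℝ →ᵇ ℝ :=
  -(Polynomial.aeval (convCLM volume k hk.continuous hk.2 X) P.derivative *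
      convCLM volume (partialX k) hk.partialX.continuous hk.partialX.2 X) -
    Polynomial.aeval (convCLM volume k hk.continuous hk.2 X) Q.derivative *
      convCLM volume (partialY k) hk.partialY.continuous hk.partialY.2 X

lemma pressureField_apply (P Q : Polynomial ℝ) (hk : IsTestFunction k) (X : ℝ × ℝ →ᵇ ℝ)
    (p : ℝ × ℝ) : pressureField P Q hk X p =
      -(P.derivative.eval (realConv X k volume p) * realConv X (partialX k) volume p) -
        Q.derivative.eval (realConv X k volume p) * realConv X (partialY k) volume p := by
  rw [pressureField, BoundedContinuousFunction.sub_apply, BoundedContinuousFunction.neg_apply,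
    BoundedContinuousFunction.mul_apply, BoundedContinuousFunction.mul_apply,
    aeval_boundedContinuousFunction_apply, aeval_boundedContinuousFunction_apply]
  rfl

lemma pressureSource_realConv (P Q : Polynomial ℝ) (hk : IsTestFunction k)
    (X : ℝ → (ℝ × ℝ →ᵇ ℝ)) : pressureSource P Q (fun t => realConv (X t) k volume) =
      fun t => ⇑(pressureField P Q hk (X t)) := by
  funext t p
  rw [pressureSource, partialX_realConv (X t).continuous hk, partialY_realConv (X t).continuous hk,
    pressureField_apply]

lemma continuous_pressureField (P Q : Polynomial ℝ) (hk : IsTestFunction k) :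
    Continuous (pressureField P Q hk) :=
  ((P.derivative.continuous_aeval.comp (ContinuousLinearMap.continuous _)).mul
    (ContinuousLinearMap.continuous _)).neg.sub
    ((Q.derivative.continuous_aeval.comp (ContinuousLinearMap.continuous _)).mul
      (ContinuousLinearMap.continuous _))

lemma isTorusPeriodic_pressureField (P Q : Polynomial ℝ) (hk : IsTestFunction k)
    {X : ℝ × ℝ →ᵇ ℝ} (hX : IsTorusPeriodic X) : IsTorusPeriodic (pressureField P Q hk X) := by
  have hρ := hX.realConv k
  have hρx := hX.realConv (partialX k)
  have hρy := hX.realConv (partialY k)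
  intro x y
  simp only [pressureField_apply, (hρ x y).1, (hρ x y).2, (hρx x y).1, (hρx x y).2, (hρy x y).1,
    (hρy x y).2, and_self]

lemma isBoundedTorusPath_pressureField {P Q : Polynomial ℝ} {hk : IsTestFunction k}
    {X : ℝ → (ℝ × ℝ →ᵇ ℝ)} (hX : ContinuousOn X (Ici 0)) (hp : ∀ t, 0 ≤ t → IsTorusPeriodic (X t))
    {B : ℝ} (hB : ∀ t, 0 ≤ t → ‖pressureField P Q hk (X t)‖ ≤ B) :
    IsBoundedTorusPath fun t => pressureField P Q hk (X t) :=
  ⟨(continuous_pressureField P Q hk).comp_continuousOn hX, ⟨B, hB⟩,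
    fun t ht => isTorusPeriodic_pressureField P Q hk (hp t ht)⟩

/-- The exponent `N` of the theorem: the pressure of a density of size `h⁻²` whose gradient has
size `h⁻³` is of size `h⁻ᴺ`. -/
noncomputable def pressureExponent (P Q : Polynomial ℝ) : ℕ :=
  2 * (P.derivative.natDegree + Q.derivative.natDegree) + 3

lemma exists_norm_pressureField_scaledKernel_le (P Q : Polynomial ℝ) {φ : ℝ × ℝ → ℝ}
    (hφ : IsTestFunction φ) (A : ℝ) : ∃ B : ℝ, 0 ≤ B ∧ ∀ {h : ℝ} (hh : 0 < h), h ≤ 1 →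
      ∀ {X : ℝ × ℝ →ᵇ ℝ}, IsTorusPeriodic X → torusL1 X ≤ A →
        ‖pressureField P Q (isTestFunction_scaledKernel hφ hh.ne') X‖ ≤
          B / h ^ pressureExponent P Q := by
  obtain ⟨C, hC₀, hC⟩ := exists_abs_realConv_scaledKernel_and_partial_le hφ
  obtain ⟨c, hc₀, hc⟩ := exists_abs_eval_mul_add_eval_mul_le P.derivative Q.derivative
  set d := P.derivative.natDegree + Q.derivative.natDegree with hd
  set K := C * |A| + 1
  refine ⟨c * K ^ d * K, by positivity, fun {h} hh hh₁ {X} hX hA => ?_⟩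
  have hCK : C * torusL1 X ≤ K :=
    (mul_le_mul_of_nonneg_left (hA.trans (le_abs_self A)) hC₀).trans (lt_add_one _).le
  have hK : 1 ≤ K := le_add_of_nonneg_left (by positivity)
  have hR : 1 ≤ K / h ^ 2 := hK.trans (le_div_self (by positivity) (by positivity)
    (pow_le_one₀ hh.le hh₁))
  have hexp : c * (K / h ^ 2) ^ d * (K / h ^ 3) = c * K ^ d * K / h ^ pressureExponent P Q := by
    rw [pressureExponent, ← hd, div_pow, ← pow_mul, pow_add]
    field_simp
    ring
  rw [← hexp]
  refine (BoundedContinuousFunction.norm_le (by positivity)).2 fun p => ?_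
  obtain ⟨hρ, hρx, hρy⟩ := hC h hh hh₁ X hX X.continuous p
  rw [← congrFun₂ (pressureSource_realConv P Q (isTestFunction_scaledKernel hφ hh.ne')
    fun _ => X) 0 p]
  exact hc hR (hρ.trans (by gcongr)) (hρx.trans (by gcongr)) (hρy.trans (by gcongr))

section IntegrationByParts

lemma contDiff_eval_mul (P : Polynomial ℝ) {E : Type*} [NormedAddCommGroup E] [NormedSpace ℝ E]
    {r ψ : E → ℝ} (hr : ContDiff ℝ 1 r) (hψ : ContDiff ℝ 1 ψ) :
    ContDiff ℝ 1 fun p => P.eval (r p) * ψ p := by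
  simp only [← Polynomial.coe_aeval_eq_eval]
  exact ((P.contDiff_aeval 1).comp hr).mul hψ

lemma fderiv_eval_mul (P : Polynomial ℝ) {E : Type*} [NormedAddCommGroup E] [NormedSpace ℝ E]
    {r ψ : E → ℝ} {p : E} (hr : DifferentiableAt ℝ r p) (hψ : DifferentiableAt ℝ ψ p) (e : E) :
    fderiv ℝ (fun q => P.eval (r q) * ψ q) p e =
      P.derivative.eval (r p) * fderiv ℝ r p e * ψ p + P.eval (r p) * fderiv ℝ ψ p e := by
  have hP : HasFDerivAt (fun q => P.eval (r q)) (P.derivative.eval (r p) • fderiv ℝ r p) p :=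
    (P.hasDerivAt (r p)).comp_hasFDerivAt p hr.hasFDerivAt
  rw [(hP.fun_mul hψ.hasFDerivAt).fderiv]
  simp only [add_apply, smul_apply, smul_eq_mul]
  ring

section

variable {E : Type*} [NormedAddCommGroup E] [NormedSpace ℝ E] [MeasurableSpace E] [BorelSpace E]
  {μ : Measure E} {g : E → ℝ}

lemma integrable_fderiv_apply [IsFiniteMeasureOnCompacts μ] (hg : ContDiff ℝ 1 g)
    (hgc : HasCompactSupport g) (e : E) : Integrable (fun p => fderiv ℝ g p e) μ :=
  ((hg.continuous_fderiv one_ne_zero).clm_apply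
    continuous_const).integrable_of_hasCompactSupport (hgc.fderiv_apply ℝ e)

lemma integral_fderiv_apply_eq_zero [FiniteDimensional ℝ E] [μ.IsAddHaarMeasure]
    (hg : ContDiff ℝ 1 g) (hgc : HasCompactSupport g) (e : E) : ∫ p, fderiv ℝ g p e ∂μ = 0 := by
  have hparts := integral_mul_fderiv_eq_neg_fderiv_mul_of_integrable (μ := μ)
    (f := fun _ => (1 : ℝ)) (g := g) (v := e) (by simp)
    (by simpa using integrable_fderiv_apply hg hgc e)
    (by simpa using hg.continuous.integrable_of_hasCompactSupport hgc)
    (fun _ _ => differentiableAt_const _) fun p _ => hg.differentiable one_ne_zero p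
  simpa using hparts

end

variable {P Q : Polynomial ℝ} {r : ℝ → ℝ × ℝ → ℝ} {t : ℝ} {ψ : ℝ × ℝ → ℝ}

lemma pressureSource_mul_sub_eq_neg_divergence (hr : Differentiable ℝ (r t))
    (hψ : IsTestFunction ψ) (p : ℝ × ℝ) :
    pressureSource P Q r t p * ψ p - P.eval (r t p) * partialX ψ p -
        Q.eval (r t p) * partialY ψ p =
      -fderiv ℝ (fun q => P.eval (r t q) * ψ q) p (1, 0) -
        fderiv ℝ (fun q => Q.eval (r t q) * ψ q) p (0, 1) := by
  rw [pressureSource, partialX_eq_fderiv (hr p), partialY_eq_fderiv (hr p), hψ.partialX_eq,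
    hψ.partialY_eq, fderiv_eval_mul P (hr p) (hψ.differentiable p),
    fderiv_eval_mul Q (hr p) (hψ.differentiable p)]
  ring

lemma integrable_pressureSource_mul_sub (hr : ContDiff ℝ 1 (r t)) (hψ : IsTestFunction ψ) :
    Integrable fun p => pressureSource P Q r t p * ψ p - P.eval (r t p) * partialX ψ p -
      Q.eval (r t p) * partialY ψ p := by
  simp_rw [pressureSource_mul_sub_eq_neg_divergence (hr.differentiable one_ne_zero) hψ]
  exact (integrable_fderiv_apply (contDiff_eval_mul P hr hψ.contDiff_one) hψ.2.mul_left _).neg.sub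
    (integrable_fderiv_apply (contDiff_eval_mul Q hr hψ.contDiff_one) hψ.2.mul_left _)

lemma integral_pressureSource_mul_sub_eq_zero (hr : ContDiff ℝ 1 (r t)) (hψ : IsTestFunction ψ) :
    ∫ p, (pressureSource P Q r t p * ψ p - P.eval (r t p) * partialX ψ p -
      Q.eval (r t p) * partialY ψ p) = 0 := by
  have hP := contDiff_eval_mul P hr hψ.contDiff_one
  have hQ := contDiff_eval_mul Q hr hψ.contDiff_one
  simp_rw [pressureSource_mul_sub_eq_neg_divergence (hr.differentiable one_ne_zero) hψ]
  rw [integral_sub (integrable_fderiv_apply hP hψ.2.mul_left _).fun_neg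
    (integrable_fderiv_apply hQ hψ.2.mul_left _), integral_neg,
    integral_fderiv_apply_eq_zero hP hψ.2.mul_left, integral_fderiv_apply_eq_zero hQ hψ.2.mul_left,
    neg_zero, sub_zero]

end IntegrationByParts

lemma IsTestFunction.exists_abs_integral_upwindCLM_add_pressureSource_sub_le {ψ : ℝ × ℝ → ℝ}
    (hψ : IsTestFunction ψ) : ∃ C : ℝ, 0 ≤ C ∧ ∀ {P Q : Polynomial ℝ} {ε : ℝ}, 0 < ε → ε ≤ 1 →
      ∀ {u v W : ℝ × ℝ →ᵇ ℝ}, IsTorusPeriodic u → IsTorusPeriodic v → IsTorusPeriodic W →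
      ∀ {r : ℝ → ℝ × ℝ → ℝ} {t : ℝ}, ContDiff ℝ 1 (r t) →
      |∫ p, ((upwindCLM ε u v W p + pressureSource P Q r t p) * ψ p -
          (u p * W p + P.eval (r t p)) * _root_.partialX ψ p -
          (v p * W p + Q.eval (r t p)) * _root_.partialY ψ p)| ≤
        C * torusL1 W * ((‖u‖ + ‖v‖) * ε) := by
  obtain ⟨C, hC₀, hC⟩ := hψ.exists_abs_integral_map_upwindCLM_sub_le
  refine ⟨C, hC₀, fun {P Q ε} hε hε₁ {u v W} hu hv hW {r t} hr => ?_⟩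
  have hsplit : ∀ p, (upwindCLM ε u v W p + pressureSource P Q r t p) * ψ p -
      (u p * W p + P.eval (r t p)) * _root_.partialX ψ p -
      (v p * W p + Q.eval (r t p)) * _root_.partialY ψ p =
        (upwindCLM ε u v W p * ψ p - (W * u) p * _root_.partialX ψ p -
          (W * v) p * _root_.partialY ψ p) +
        (pressureSource P Q r t p * ψ p - P.eval (r t p) * _root_.partialX ψ p -
          Q.eval (r t p) * _root_.partialY ψ p) := fun p => by
    simp only [BoundedContinuousFunction.mul_apply]
    ring
  have hint : Integrable fun p => upwindCLM ε u v W p * ψ p -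
      (W * u) p * _root_.partialX ψ p - (W * v) p * _root_.partialY ψ p :=
    ((hψ.integrable_mul (BoundedContinuousFunction.continuous _).locallyIntegrable).sub
      (hψ.partialX.integrable_mul (BoundedContinuousFunction.continuous _).locallyIntegrable)).sub
      (hψ.partialY.integrable_mul (BoundedContinuousFunction.continuous _).locallyIntegrable)
  simp_rw [hsplit]
  rw [integral_add hint (integrable_pressureSource_mul_sub hr hψ),
    integral_pressureSource_mul_sub_eq_zero hr hψ, add_zero]
  simpa only [mul_one, ContinuousLinearMap.id_apply] using
    hC 1 _ isTorusMultiplier_id ε hε hε₁ u v W hu hv hW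

end Pressure

section WeakForms

lemma tendsto_rpow_nhdsGT_zero {s : ℝ} (hs : 0 < s) :
    Tendsto (fun ε : ℝ => ε ^ s) (𝓝[>] 0) (𝓝 0) := by
  have hcont := (Real.continuousAt_rpow_const 0 s (Or.inr hs.le)).tendsto
  rw [Real.zero_rpow hs.ne'] at hcont
  exact hcont.mono_left nhdsWithin_le_nhds

variable {q F G D : ℝ → ℝ → ℝ × ℝ → ℝ}

lemma isWeakAsymptoticMethod_of_abs_integral_le
    (hq : ∀ ε ∈ Ioo (0 : ℝ) 1, ∀ t : ℝ, 0 ≤ t → ∀ p : ℝ × ℝ,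
      HasDerivWithinAt (fun s : ℝ => q ε s p) (D ε t p) (Ici 0) t)
    (hD : ∀ ε ∈ Ioo (0 : ℝ) 1, ∀ t : ℝ, 0 ≤ t → LocallyIntegrable (D ε t))
    (hF : ∀ ε ∈ Ioo (0 : ℝ) 1, ∀ t : ℝ, 0 ≤ t → LocallyIntegrable (F ε t))
    (hG : ∀ ε ∈ Ioo (0 : ℝ) 1, ∀ t : ℝ, 0 ≤ t → LocallyIntegrable (G ε t))
    (hbound : ∀ ψ : ℝ × ℝ → ℝ, IsTestFunction ψ → ∀ δ : ℝ, 0 < δ → ∃ η : ℝ → ℝ,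
      Tendsto η (𝓝[>] 0) (𝓝 0) ∧ ∀ ε ∈ Ioo (0 : ℝ) 1, ∀ t ∈ Icc 0 δ,
        |∫ p, (D ε t p * ψ p - F ε t p * partialX ψ p - G ε t p * partialY ψ p)| ≤ η ε) :
    IsWeakAsymptoticMethod q F G := by
  have hweak : ∀ ψ, ∀ ε ∈ Ioo (0 : ℝ) 1, ∀ t : ℝ, 0 ≤ t →
      weakIntegrand (q ε) (F ε) (G ε) ψ t =
        fun p => D ε t p * ψ p - F ε t p * partialX ψ p - G ε t p * partialY ψ p := by
    intro ψ ε hε t ht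
    funext p
    rw [weakIntegrand, (hq ε hε t ht p).derivWithin (uniqueDiffOn_Ici 0 t ht)]
  refine ⟨fun ε hε t ht p => (hq ε hε t ht p).differentiableWithinAt, fun ψ hψ =>
    ⟨fun ε hε t ht => ?_, fun δ hδ => ?_⟩⟩
  · rw [hweak ψ ε hε t ht]
    exact ((hψ.integrable_mul (hD ε hε t ht)).sub (hψ.partialX.integrable_mul (hF ε hε t ht))).sub
      (hψ.partialY.integrable_mul (hG ε hε t ht))
  · obtain ⟨η, hη, hηbound⟩ := hbound ψ hψ δ hδ
    rw [Metric.tendstoUniformlyOn_iff]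
    intro r hr
    filter_upwards [hη.eventually_lt_const hr, Ioo_mem_nhdsGT (zero_lt_one (α := ℝ))]
      with ε hηr hε t ht
    rw [hweak ψ ε hε t ht.1, Real.dist_eq, zero_sub, abs_neg]
    exact (hηbound ε hε t ht).trans_lt hηr

lemma attainsInitialData_of_abs_integral_sub_le {f : ℝ → (ℝ × ℝ →ᵇ ℝ)} (hf : IsInitialFamily f)
    (hbound : ∀ ψ : ℝ × ℝ → ℝ, IsTestFunction ψ → ∃ η : ℝ → ℝ, Tendsto η (𝓝[>] 0) (𝓝 0) ∧
      ∀ ε ∈ Ioo (0 : ℝ) 1, |(∫ p, q ε 0 p * ψ p) - ∫ p, f ε p * ψ p| ≤ η ε) :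
    AttainsInitialData f q := by
  intro f₀ hf₀ hf₀i hlim ψ hψ
  obtain ⟨η, hη, hηbound⟩ := hbound ψ hψ
  obtain ⟨C, -, hC⟩ := hψ.exists_abs_integral_mul_le
  have hmem : Ioo (0 : ℝ) 1 ∈ 𝓝[>] 0 := Ioo_mem_nhdsGT one_pos
  have hqf : Tendsto (fun ε => (∫ p, q ε 0 p * ψ p) - ∫ p, f ε p * ψ p) (𝓝[>] 0) (𝓝 0) :=
    squeeze_zero_norm' (eventually_of_mem hmem hηbound) hη
  have hff₀ : Tendsto (fun ε => (∫ p, f ε p * ψ p) - ∫ p, f₀ p * ψ p) (𝓝[>] 0) (𝓝 0) := by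
    refine squeeze_zero_norm' (eventually_of_mem hmem fun ε hε => ?_)
      (by simpa using hlim.const_mul C)
    have hfi := (f ε).continuous.locallyIntegrable (μ := volume)
    rw [← integral_sub (hψ.integrable_mul hfi) (hψ.integrable_mul hf₀i)]
    simpa only [sub_mul, Real.norm_eq_abs] using hC _ ((hf.periodic ε hε).sub hf₀) (hfi.sub hf₀i)
  simpa using (hqf.add hff₀).add_const (∫ p, f₀ p * ψ p)

end WeakForms

section Families

lemma IsInitialFamily.exists_torusL1_le {f : ℝ → (ℝ × ℝ →ᵇ ℝ)} (hf : IsInitialFamily f) :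
    ∃ C : ℝ, 0 ≤ C ∧ ∀ ε ∈ Ioo (0 : ℝ) 1, torusL1 (f ε) ≤ C := by
  obtain ⟨C, hC⟩ := hf.bounded
  exact ⟨|C|, abs_nonneg C, fun ε hε => (hC ε hε).trans (le_abs_self C)⟩

namespace IsVelocityFamily

variable {β : ℝ} {u : ℝ → ℝ → (ℝ × ℝ →ᵇ ℝ)}

lemma exists_norm_le (hu : IsVelocityFamily β u) :
    ∃ M : ℝ, ∀ ε ∈ Ioo (0 : ℝ) 1, ∀ t : ℝ, 0 ≤ t → ‖u ε t‖ ≤ M := by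
  obtain ⟨M, hM⟩ := hu.bounded
  exact ⟨|M|, fun ε hε t ht => (BoundedContinuousFunction.norm_le (abs_nonneg M)).2
    fun p => (hM ε hε t ht p).trans (le_abs_self M)⟩

lemma isBoundedTorusPath (hu : IsVelocityFamily β u) {ε : ℝ} (hε : ε ∈ Ioo (0 : ℝ) 1) :
    IsBoundedTorusPath (u ε) := by
  obtain ⟨M, hM⟩ := hu.exists_norm_le
  exact ⟨hu.continuous_time ε hε, ⟨M, hM ε hε⟩, hu.periodic ε hε⟩

lemma exists_lipschitzWith (hu : IsVelocityFamily β u) {δ : ℝ} (hδ : 0 < δ) :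
    ∃ c : ℝ, 0 ≤ c ∧ ∀ ε ∈ Ioo (0 : ℝ) 1, ∀ t ∈ Icc 0 δ,
      LipschitzWith (c / ε ^ β).toNNReal (u ε t) := by
  obtain ⟨c, hc⟩ := hu.gradient_bound δ hδ
  refine ⟨2 * |c|, by positivity, fun ε hε t ht => ?_⟩
  refine (lipschitzWith_of_abs_partial_le (hu.differentiable ε hε t ht.1) (hc ε hε t ht)).weaken ?_
  have hεβ := Real.rpow_pos_of_pos hε.1 β
  rw [mul_div_assoc]
  gcongr
  exact le_abs_self c

end IsVelocityFamily

/-- A source term given by a continuous path of periodic functions in `C_b(ℝ²)` of norm at most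
`B`. -/
def IsTorusSource (B : ℝ) (S : ℝ → ℝ × ℝ → ℝ) : Prop :=
  ∃ b : ℝ → (ℝ × ℝ →ᵇ ℝ), IsBoundedTorusPath b ∧ (∀ t, 0 ≤ t → ‖b t‖ ≤ B) ∧ S = fun t => ⇑(b t)

lemma isTorusSource_zero : IsTorusSource 0 fun _ _ => 0 :=
  ⟨0, isBoundedTorusPath_zero, fun _ _ => norm_zero.le, rfl⟩

/-- A family, indexed by the step `ε ∈ (0, 1)`, of solutions of the upwind equation with admissible
velocities `u`, `v` and initial data `X₀`, and with sources `S ε` of size at most `B ε`. -/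
structure IsUpwindFamily (β : ℝ) (B : ℝ → ℝ) (u v : ℝ → ℝ → (ℝ × ℝ →ᵇ ℝ))
    (S : ℝ → ℝ → ℝ × ℝ → ℝ) (X₀ : ℝ → (ℝ × ℝ →ᵇ ℝ)) (X : ℝ → ℝ → (ℝ × ℝ →ᵇ ℝ)) : Prop where
  velocity_fst : IsVelocityFamily β u
  velocity_snd : IsVelocityFamily β v
  initial : IsInitialFamily X₀
  source : ∀ ε ∈ Ioo (0 : ℝ) 1, IsTorusSource (B ε) (S ε)
  solution : ∀ ε ∈ Ioo (0 : ℝ) 1, IsUpwindSolution ε (u ε) (v ε) (S ε) (X₀ ε) (X ε)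

lemma exists_isUpwindFamily {β : ℝ} {B : ℝ → ℝ} {u v : ℝ → ℝ → (ℝ × ℝ →ᵇ ℝ)}
    {S : ℝ → ℝ → ℝ × ℝ → ℝ} {X₀ : ℝ → (ℝ × ℝ →ᵇ ℝ)} (hu : IsVelocityFamily β u)
    (hv : IsVelocityFamily β v) (h₀ : IsInitialFamily X₀)
    (hS : ∀ ε ∈ Ioo (0 : ℝ) 1, IsTorusSource (B ε) (S ε)) :
    ∃ X, IsUpwindFamily β B u v S X₀ X := by
  have hsol : ∀ ε ∈ Ioo (0 : ℝ) 1, ∃ Xε, IsUpwindSolution ε (u ε) (v ε) (S ε) (X₀ ε) Xε :=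
    fun ε hε => by
      obtain ⟨b, hb, -, hSb⟩ := hS ε hε
      rw [hSb]
      exact exists_isUpwindSolution hε.1 (hu.isBoundedTorusPath hε) (hv.isBoundedTorusPath hε) hb _
  choose! X hX using hsol
  exact ⟨X, hu, hv, h₀, hS, hX⟩

namespace IsUpwindFamily

variable {β : ℝ} {B : ℝ → ℝ} {u v X : ℝ → ℝ → (ℝ × ℝ →ᵇ ℝ)} {S : ℝ → ℝ → ℝ × ℝ → ℝ}
  {X₀ : ℝ → (ℝ × ℝ →ᵇ ℝ)} {ε t : ℝ}

lemma exists_norm_velocity_le (hX : IsUpwindFamily β B u v S X₀ X) :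
    ∃ M : ℝ, ∀ ε ∈ Ioo (0 : ℝ) 1, ∀ t : ℝ, 0 ≤ t → ‖u ε t‖ + ‖v ε t‖ ≤ M := by
  obtain ⟨Mu, hMu⟩ := hX.velocity_fst.exists_norm_le
  obtain ⟨Mv, hMv⟩ := hX.velocity_snd.exists_norm_le
  exact ⟨Mu + Mv, fun ε hε t ht => add_le_add (hMu ε hε t ht) (hMv ε hε t ht)⟩

lemma exists_lipschitzWith_velocity (hX : IsUpwindFamily β B u v S X₀ X) {δ : ℝ} (hδ : 0 < δ) :
    ∃ c : ℝ, 0 ≤ c ∧ ∀ ε ∈ Ioo (0 : ℝ) 1, ∀ t ∈ Icc 0 δ,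
      LipschitzWith (c / ε ^ β).toNNReal (u ε t) ∧ LipschitzWith (c / ε ^ β).toNNReal (v ε t) := by
  obtain ⟨c, hc₀, hc⟩ := hX.velocity_fst.exists_lipschitzWith hδ
  obtain ⟨d, hd₀, hd⟩ := hX.velocity_snd.exists_lipschitzWith hδ
  refine ⟨c + d, by positivity, fun ε hε t ht => ?_⟩
  have hεβ := Real.rpow_pos_of_pos hε.1 β
  exact ⟨(hc ε hε t ht).weaken (by gcongr; exact le_add_of_nonneg_right hd₀),
    (hd ε hε t ht).weaken (by gcongr; exact le_add_of_nonneg_left hc₀)⟩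

lemma isUniqueUpwindSolution (hX : IsUpwindFamily β B u v S X₀ X) (hε : ε ∈ Ioo (0 : ℝ) 1) :
    IsUniqueUpwindSolution ε (u ε) (v ε) (S ε) (X₀ ε) (X ε) := by
  have hsol := hX.solution ε hε
  refine ⟨hsol, fun Y hY t ht => ?_⟩
  obtain ⟨b, -, -, hSb⟩ := hX.source ε hε
  rw [hSb] at hsol hY
  exact hsol.eq hε.1 (hX.velocity_fst.isBoundedTorusPath hε)
    (hX.velocity_snd.isBoundedTorusPath hε) hY ht

lemma isTorusPeriodic (hX : IsUpwindFamily β B u v S X₀ X) (hε : ε ∈ Ioo (0 : ℝ) 1)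
    (ht : 0 ≤ t) : IsTorusPeriodic (X ε t) := by
  have hsol := hX.solution ε hε
  obtain ⟨b, hb, -, hSb⟩ := hX.source ε hε
  rw [hSb] at hsol
  exact hsol.isTorusPeriodic hε.1 (hX.velocity_fst.isBoundedTorusPath hε)
    (hX.velocity_snd.isBoundedTorusPath hε) hb (hX.initial.periodic ε hε) ht

lemma torusL1_le (hX : IsUpwindFamily β B u v S X₀ X) (hε : ε ∈ Ioo (0 : ℝ) 1) (ht : 0 ≤ t) :
    torusL1 (X ε t) ≤ torusL1 (X₀ ε) + (2 * Real.pi) ^ 2 * B ε * t := by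
  have hsol := hX.solution ε hε
  obtain ⟨b, hb, hbB, hSb⟩ := hX.source ε hε
  rw [hSb] at hsol
  exact hsol.torusL1_le hε.1 (hX.velocity_fst.isBoundedTorusPath hε)
    (hX.velocity_snd.isBoundedTorusPath hε) hb (hX.initial.periodic ε hε)
    (fun t ht => (torusL1_le_norm (b t)).trans (by gcongr; exact hbB t ht)) ht

lemma exists_hasDerivWithinAt (hX : IsUpwindFamily β B u v S X₀ X) (hε : ε ∈ Ioo (0 : ℝ) 1)
    (ht : 0 ≤ t) : ∃ b : ℝ × ℝ →ᵇ ℝ, S ε t = b ∧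
      HasDerivWithinAt (X ε) (upwindCLM ε (u ε t) (v ε t) (X ε t) + b) (Ici 0) t := by
  have hsol := hX.solution ε hε
  obtain ⟨b, -, -, hSb⟩ := hX.source ε hε
  rw [hSb] at hsol
  exact ⟨b t, congrFun hSb t, hsol.hasDerivWithinAt ht⟩

lemma continuousOn (hX : IsUpwindFamily β B u v S X₀ X) (hε : ε ∈ Ioo (0 : ℝ) 1) :
    ContinuousOn (X ε) (Ici 0) := fun t ht => by
  obtain ⟨b, -, hderiv⟩ := hX.exists_hasDerivWithinAt hε ht
  exact hderiv.continuousWithinAt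

lemma attainsInitialData (hX : IsUpwindFamily β B u v S X₀ X) :
    AttainsInitialData X₀ fun ε t p => X ε t p :=
  attainsInitialData_of_abs_integral_sub_le hX.initial fun _ _ =>
    ⟨0, tendsto_const_nhds, fun ε hε => by simp [(hX.solution ε hε).1]⟩

lemma attainsInitialData_mollified (hX : IsUpwindFamily β B u v S X₀ X) {φ : ℝ × ℝ → ℝ}
    (hφ : Continuous φ) (hφc : HasCompactSupport φ) (hφ₁ : ∫ p, φ p = 1) {α : ℝ} (hα : 0 < α) :
    AttainsInitialData X₀ (mollified φ α X) := by
  refine attainsInitialData_of_abs_integral_sub_le hX.initial fun ψ hψ => ?_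
  obtain ⟨C, hC₀, hC⟩ := hψ.exists_abs_integral_realConv_scaledKernel_mul_sub_le hφ hφc
  obtain ⟨A, -, hA⟩ := hX.initial.exists_torusL1_le
  refine ⟨fun ε => C * A * ε ^ α, by simpa using (tendsto_rpow_nhdsGT_zero hα).const_mul (C * A),
    fun ε hε => ?_⟩
  have hh := Real.rpow_pos_of_pos hε.1 α
  have herr := hC _ hh (Real.rpow_le_one hε.1.le hε.2.le hα.le) (X₀ ε) (hX.initial.periodic ε hε)
    (X₀ ε).continuous
  rw [hφ₁, one_mul] at herr
  simp only [mollified, (hX.solution ε hε).1]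
  refine herr.trans ?_
  gcongr
  exact hA ε hε

end IsUpwindFamily

end Families

section Density

lemma rpow_natCast_mul {ε : ℝ} (hε : 0 ≤ ε) (n : ℕ) (α : ℝ) : ε ^ ((n : ℝ) * α) = (ε ^ α) ^ n := by
  rw [mul_comm, Real.rpow_mul hε, Real.rpow_natCast]

lemma hasDerivWithinAt_boundedContinuousFunction_apply {T : Type*} [TopologicalSpace T]
    {X : ℝ → (T →ᵇ ℝ)} {D : T →ᵇ ℝ} {s : Set ℝ} {t : ℝ} (hX : HasDerivWithinAt X D s t) (p : T) :
    HasDerivWithinAt (fun r => X r p) (D p) s t :=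
  (BoundedContinuousFunction.evalCLM (β := ℝ) ℝ p).hasFDerivAt.comp_hasDerivWithinAt t hX

lemma contDiff_mollified {φ : ℝ × ℝ → ℝ} (hφ : IsTestFunction φ) (α : ℝ)
    (X : ℝ → ℝ → (ℝ × ℝ →ᵇ ℝ)) {ε : ℝ} (hε : 0 < ε) (t : ℝ) :
    ContDiff ℝ ∞ (mollified φ α X ε t) :=
  contDiff_realConv (X ε t).continuous
    (isTestFunction_scaledKernel hφ (Real.rpow_pos_of_pos hε α).ne')

namespace IsUpwindFamily

variable {α β : ℝ} {u v X : ℝ → ℝ → (ℝ × ℝ →ᵇ ℝ)} {ρ₀ : ℝ → (ℝ × ℝ →ᵇ ℝ)} {φ : ℝ × ℝ → ℝ}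

lemma torusL1_le_torusL1_initial (hX : IsUpwindFamily β 0 u v (fun _ _ _ => 0) ρ₀ X) {ε t : ℝ}
    (hε : ε ∈ Ioo (0 : ℝ) 1) (ht : 0 ≤ t) : torusL1 (X ε t) ≤ torusL1 (ρ₀ ε) := by
  simpa using hX.torusL1_le hε ht

lemma exists_torusL1_le (hX : IsUpwindFamily β 0 u v (fun _ _ _ => 0) ρ₀ X) :
    ∃ A : ℝ, 0 ≤ A ∧ ∀ ε ∈ Ioo (0 : ℝ) 1, ∀ t : ℝ, 0 ≤ t → torusL1 (X ε t) ≤ A := by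
  obtain ⟨A, hA₀, hA⟩ := hX.initial.exists_torusL1_le
  exact ⟨A, hA₀, fun ε hε t ht => (hX.torusL1_le_torusL1_initial hε ht).trans (hA ε hε)⟩

lemma exists_abs_mollified_and_partial_le (hX : IsUpwindFamily β 0 u v (fun _ _ _ => 0) ρ₀ X)
    (hφ : IsTestFunction φ) (hα : 0 < α) :
    ∃ M : ℝ, ∀ ε ∈ Ioo (0 : ℝ) 1, ∀ t : ℝ, 0 ≤ t → ∀ p : ℝ × ℝ,
      |mollified φ α X ε t p| ≤ M / ε ^ (2 * α) ∧
      |partialX (mollified φ α X ε t) p| ≤ M / ε ^ (3 * α) ∧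
      |partialY (mollified φ α X ε t) p| ≤ M / ε ^ (3 * α) := by
  obtain ⟨A, -, hA⟩ := hX.exists_torusL1_le
  obtain ⟨C, hC₀, hC⟩ := exists_abs_realConv_scaledKernel_and_partial_le hφ
  refine ⟨C * A, fun ε hε t ht p => ?_⟩
  have hh := Real.rpow_pos_of_pos hε.1 α
  have hCA := mul_le_mul_of_nonneg_left (hA ε hε t ht) hC₀
  obtain ⟨hρ, hρx, hρy⟩ := hC _ hh (Real.rpow_le_one hε.1.le hε.2.le hα.le) (X ε t)
    (hX.isTorusPeriodic hε ht) (X ε t).continuous p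
  have h₂ : ε ^ (2 * α) = (ε ^ α) ^ 2 := mod_cast rpow_natCast_mul hε.1.le 2 α
  have h₃ : ε ^ (3 * α) = (ε ^ α) ^ 3 := mod_cast rpow_natCast_mul hε.1.le 3 α
  rw [h₂, h₃]
  exact ⟨hρ.trans (by gcongr), hρx.trans (by gcongr), hρy.trans (by gcongr)⟩

lemma exists_isTorusSource_pressureSource (hX : IsUpwindFamily β 0 u v (fun _ _ _ => 0) ρ₀ X)
    (P Q : Polynomial ℝ) (hφ : IsTestFunction φ) (hα : 0 < α) :
    ∃ B : ℝ, ∀ ε ∈ Ioo (0 : ℝ) 1, IsTorusSource (B / ε ^ ((pressureExponent P Q : ℝ) * α))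
      (pressureSource P Q (mollified φ α X ε)) := by
  obtain ⟨A, -, hA⟩ := hX.exists_torusL1_le
  obtain ⟨B, -, hB⟩ := exists_norm_pressureField_scaledKernel_le P Q hφ A
  refine ⟨B, fun ε hε => ?_⟩
  have hh := Real.rpow_pos_of_pos hε.1 α
  have hbound := fun t (ht : 0 ≤ t) => hB hh (Real.rpow_le_one hε.1.le hε.2.le hα.le)
    (hX.isTorusPeriodic hε ht) (hA ε hε t ht)
  rw [rpow_natCast_mul hε.1.le]
  exact ⟨fun t => pressureField P Q (isTestFunction_scaledKernel hφ hh.ne') (X ε t),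
    isBoundedTorusPath_pressureField (hX.continuousOn hε)
      (fun t ht => hX.isTorusPeriodic hε ht) hbound, hbound, pressureSource_realConv P Q _ (X ε)⟩

lemma hasDerivWithinAt_mollified (hX : IsUpwindFamily β 0 u v (fun _ _ _ => 0) ρ₀ X)
    (hφ : Continuous φ) (hφc : HasCompactSupport φ) {ε t : ℝ} (hε : ε ∈ Ioo (0 : ℝ) 1)
    (ht : 0 ≤ t) (p : ℝ × ℝ) :
    HasDerivWithinAt (fun s => mollified φ α X ε s p)
      (realConv (upwindCLM ε (u ε t) (v ε t) (X ε t)) (scaledKernel φ (ε ^ α)) volume p)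
      (Ici 0) t := by
  obtain ⟨b, hb, hderiv⟩ := hX.exists_hasDerivWithinAt hε ht
  obtain rfl : b = 0 := DFunLike.coe_injective hb.symm
  rw [add_zero] at hderiv
  exact hasDerivWithinAt_boundedContinuousFunction_apply
    ((convCLM volume (scaledKernel φ (ε ^ α)) (continuous_scaledKernel hφ _)
      (hasCompactSupport_scaledKernel hφc
        (Real.rpow_pos_of_pos hε.1 α).ne')).hasFDerivAt.comp_hasDerivWithinAt t hderiv) p

lemma exists_abs_integral_convCLM_upwindCLM_sub_le
    (hX : IsUpwindFamily β 0 u v (fun _ _ _ => 0) ρ₀ X) (hφ : IsTestFunction φ)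
    {ψ : ℝ × ℝ → ℝ} (hψ : IsTestFunction ψ) {δ : ℝ} (hδ : 0 < δ) :
    ∃ C M c : ℝ, ∀ ε ∈ Ioo (0 : ℝ) 1, ∀ t ∈ Icc 0 δ,
      |∫ p, (realConv (upwindCLM ε (u ε t) (v ε t) (X ε t)) (scaledKernel φ (ε ^ α)) volume p *
          ψ p - u ε t p * mollified φ α X ε t p * partialX ψ p -
          v ε t p * mollified φ α X ε t p * partialY ψ p)| ≤
        C * (M * ε ^ (1 : ℝ) + c * ε ^ (α - β)) := by
  obtain ⟨C, hC₀, hC⟩ := hψ.exists_abs_integral_convCLM_scaledKernel_upwindCLM_sub_le hφ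
  obtain ⟨A, hA₀, hA⟩ := hX.exists_torusL1_le
  obtain ⟨M, hM⟩ := hX.exists_norm_velocity_le
  obtain ⟨c, hc₀, hc⟩ := hX.exists_lipschitzWith_velocity hδ
  refine ⟨C * A, M, c, fun ε hε t ht => ?_⟩
  have hε₀ := hε.1
  have hh := Real.rpow_pos_of_pos hε₀ α
  have hΛ : ((c / ε ^ β).toNNReal : ℝ) * ε ^ α = c * ε ^ (α - β) := by
    rw [Real.coe_toNNReal _ (by positivity), Real.rpow_sub hε₀]
    ring
  refine (hC hh hε₀ hε.2.le (hX.velocity_fst.periodic ε hε t ht.1)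
    (hX.velocity_snd.periodic ε hε t ht.1) (hX.isTorusPeriodic hε ht.1) (hc ε hε t ht).1
    (hc ε hε t ht).2).trans ?_
  rw [hΛ, Real.rpow_one]
  gcongr
  exacts [hA ε hε t ht.1, hM ε hε t ht.1]

lemma isWeakAsymptoticMethod_mollified (hX : IsUpwindFamily β 0 u v (fun _ _ _ => 0) ρ₀ X)
    (hφ : IsTestFunction φ) (hβα : β < α) :
    IsWeakAsymptoticMethod (mollified φ α X) (fun ε t p => u ε t p * mollified φ α X ε t p)
      fun ε t p => v ε t p * mollified φ α X ε t p := by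
  refine isWeakAsymptoticMethod_of_abs_integral_le
    (fun ε hε t ht => hX.hasDerivWithinAt_mollified hφ.continuous hφ.2 hε ht)
    (fun ε hε t _ => ?_) (fun ε hε t _ => ?_) (fun ε hε t _ => ?_) fun ψ hψ δ hδ => ?_
  · exact (continuous_realConv (BoundedContinuousFunction.continuous _)
      (continuous_scaledKernel hφ.continuous _) (hasCompactSupport_scaledKernel hφ.2
        (Real.rpow_pos_of_pos hε.1 α).ne')).locallyIntegrable
  · exact ((u ε t).continuous.mul (contDiff_mollified hφ α X hε.1 t).continuous).locallyIntegrable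
  · exact ((v ε t).continuous.mul (contDiff_mollified hφ α X hε.1 t).continuous).locallyIntegrable
  · obtain ⟨C, M, c, hbound⟩ := hX.exists_abs_integral_convCLM_upwindCLM_sub_le hφ hψ hδ
    refine ⟨_, ?_, hbound⟩
    have hscheme := (tendsto_rpow_nhdsGT_zero one_pos).const_mul M
    have hcommutator := (tendsto_rpow_nhdsGT_zero (sub_pos.2 hβα)).const_mul c
    simpa using (hscheme.add hcommutator).const_mul C

end IsUpwindFamily

end Density

section Momentum

namespace IsUpwindFamily

variable {β B s : ℝ} {u v w : ℝ → ℝ → (ℝ × ℝ →ᵇ ℝ)} {S r : ℝ → ℝ → ℝ × ℝ → ℝ}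
  {w₀ : ℝ → (ℝ × ℝ →ᵇ ℝ)}

lemma exists_torusL1_le_one_add_div_rpow
    (hw : IsUpwindFamily β (fun ε => B / ε ^ s) u v S w₀ w) (hs : 0 ≤ s) :
    ∃ C : ℝ, 0 < C ∧ ∀ ε ∈ Ioo (0 : ℝ) 1, ∀ t : ℝ, 0 ≤ t →
      torusL1 (w ε t) ≤ C * (1 + t) / ε ^ s := by
  obtain ⟨A, hA₀, hA⟩ := hw.initial.exists_torusL1_le
  set K := (2 * Real.pi) ^ 2 * |B| with hK
  refine ⟨A + K + 1, by positivity, fun ε hε t ht => (hw.torusL1_le hε ht).trans ?_⟩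
  have hεs := Real.rpow_pos_of_pos hε.1 s
  have hAs : torusL1 (w₀ ε) ≤ A / ε ^ s :=
    (hA ε hε).trans (le_div_self hA₀ hεs (Real.rpow_le_one hε.1.le hε.2.le hs))
  calc torusL1 (w₀ ε) + (2 * Real.pi) ^ 2 * (B / ε ^ s) * t
      ≤ A / ε ^ s + (2 * Real.pi) ^ 2 * (|B| / ε ^ s) * t := by
        gcongr
        exact le_abs_self B
    _ = (A + K * t) / ε ^ s := by rw [hK]; ring
    _ ≤ (A + K + 1) * (1 + t) / ε ^ s := by
        gcongr
        have hK₀ : 0 ≤ K := by positivity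
        nlinarith [mul_nonneg hA₀ ht]

lemma isWeakAsymptoticMethod_pressureSource {P Q : Polynomial ℝ}
    (hw : IsUpwindFamily β (fun ε => B / ε ^ s) u v (fun ε => pressureSource P Q (r ε)) w₀ w)
    (hr : ∀ ε ∈ Ioo (0 : ℝ) 1, ∀ t, 0 ≤ t → ContDiff ℝ 1 (r ε t)) (hs : 0 ≤ s) (hs₁ : s < 1) :
    IsWeakAsymptoticMethod (fun ε t p => w ε t p)
      (fun ε t p => u ε t p * w ε t p + P.eval (r ε t p))
      fun ε t p => v ε t p * w ε t p + Q.eval (r ε t p) := by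
  refine isWeakAsymptoticMethod_of_abs_integral_le
    (D := fun ε t p => upwindCLM ε (u ε t) (v ε t) (w ε t) p + pressureSource P Q (r ε) t p)
    (fun ε hε t ht p => ?_) (fun ε hε t ht => ?_) (fun ε hε t ht => ?_) (fun ε hε t ht => ?_)
    fun ψ hψ δ hδ => ?_
  · obtain ⟨b, hb, hderiv⟩ := hw.exists_hasDerivWithinAt hε ht
    simpa only [hb, BoundedContinuousFunction.add_apply] using
      hasDerivWithinAt_boundedContinuousFunction_apply hderiv p
  · obtain ⟨b, hb, -⟩ := hw.exists_hasDerivWithinAt hε ht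
    simp only [hb]
    exact ((BoundedContinuousFunction.continuous _).add b.continuous).locallyIntegrable
  · exact (((u ε t).continuous.mul (w ε t).continuous).add
      (P.continuous.comp (hr ε hε t ht).continuous)).locallyIntegrable
  · exact (((v ε t).continuous.mul (w ε t).continuous).add
      (Q.continuous.comp (hr ε hε t ht).continuous)).locallyIntegrable
  · obtain ⟨C, hC₀, hC⟩ := hψ.exists_abs_integral_upwindCLM_add_pressureSource_sub_le
    obtain ⟨A, hA₀, hA⟩ := hw.exists_torusL1_le_one_add_div_rpow hs
    obtain ⟨M, hM⟩ := hw.exists_norm_velocity_le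
    refine ⟨fun ε => C * (A * (1 + δ)) * M * ε ^ (1 - s), by
      simpa using (tendsto_rpow_nhdsGT_zero (sub_pos.2 hs₁)).const_mul (C * (A * (1 + δ)) * M),
      fun ε hε t ht => ?_⟩
    have hε₀ := hε.1
    refine (hC hε₀ hε.2.le (hw.velocity_fst.periodic ε hε t ht.1)
      (hw.velocity_snd.periodic ε hε t ht.1) (hw.isTorusPeriodic hε ht.1)
      (hr ε hε t ht.1)).trans ?_
    calc C * torusL1 (w ε t) * ((‖u ε t‖ + ‖v ε t‖) * ε)
        ≤ C * (A * (1 + δ) / ε ^ s) * (M * ε) := by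
          gcongr
          · refine (hA ε hε t ht.1).trans ?_
            gcongr
            exact ht.2
          · exact hM ε hε t ht.1
      _ = C * (A * (1 + δ)) * M * ε ^ (1 - s) := by
          rw [Real.rpow_sub hε₀, Real.rpow_one]
          ring

end IsUpwindFamily

end Momentum

theorem mainTheorem6_general (P Q : Polynomial ℝ) {α β : ℝ} (hα : 0 < α) (hβα : β < α)
    {φ : ℝ × ℝ → ℝ} (hφ : IsTestFunction φ) (hφ₁ : ∫ p, φ p = 1)
    {u v : ℝ → ℝ → (ℝ × ℝ →ᵇ ℝ)} (hu : IsVelocityFamily β u) (hv : IsVelocityFamily β v)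
    {ρ₀ w₀ : ℝ → (ℝ × ℝ →ᵇ ℝ)} (hρ₀ : IsInitialFamily ρ₀) (hw₀ : IsInitialFamily w₀) :
    ∃ X w : ℝ → ℝ → (ℝ × ℝ →ᵇ ℝ),
      (∀ ε ∈ Set.Ioo (0 : ℝ) 1,
        IsUniqueUpwindSolution ε (u ε) (v ε) (fun _ _ => 0) (ρ₀ ε) (X ε) ∧
        IsUniqueUpwindSolution ε (u ε) (v ε)
          (pressureSource P Q (mollified φ α X ε)) (w₀ ε) (w ε) ∧
        ∀ t : ℝ, 0 ≤ t → IsTorusPeriodic (X ε t) ∧ IsTorusPeriodic (w ε t)) ∧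
      (∃ C : ℝ, ∀ ε ∈ Set.Ioo (0 : ℝ) 1, ∀ t : ℝ, 0 ≤ t →
        torusL1 (X ε t) ≤ torusL1 (ρ₀ ε) ∧ torusL1 (ρ₀ ε) ≤ C) ∧
      (∃ M : ℝ, ∀ ε ∈ Set.Ioo (0 : ℝ) 1, ∀ t : ℝ, 0 ≤ t →
        ContDiff ℝ ∞ (mollified φ α X ε t) ∧ ∀ p : ℝ × ℝ,
          |mollified φ α X ε t p| ≤ M / ε ^ (2 * α) ∧
          |partialX (mollified φ α X ε t) p| ≤ M / ε ^ (3 * α) ∧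
          |partialY (mollified φ α X ε t) p| ≤ M / ε ^ (3 * α)) ∧
      (∃ C : ℝ, 0 < C ∧ ∀ ε ∈ Set.Ioo (0 : ℝ) 1, ∀ t : ℝ, 0 ≤ t →
        torusL1 (w ε t) ≤ C * (1 + t) / ε ^ ((pressureExponent P Q : ℝ) * α)) ∧
      IsWeakAsymptoticMethod (mollified φ α X)
        (fun ε t p => u ε t p * mollified φ α X ε t p)
        (fun ε t p => v ε t p * mollified φ α X ε t p) ∧
      AttainsInitialData ρ₀ (mollified φ α X) ∧
      ((pressureExponent P Q : ℝ) * α < 1 →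
        IsWeakAsymptoticMethod (fun ε t p => w ε t p)
          (fun ε t p => u ε t p * w ε t p + P.eval (mollified φ α X ε t p))
          (fun ε t p => v ε t p * w ε t p + Q.eval (mollified φ α X ε t p))) ∧
      AttainsInitialData w₀ (fun ε t p => w ε t p) := by
  obtain ⟨X, hX⟩ := exists_isUpwindFamily (B := 0) hu hv hρ₀ fun _ _ => isTorusSource_zero
  obtain ⟨B, hB⟩ := hX.exists_isTorusSource_pressureSource P Q hφ hα
  obtain ⟨w, hw⟩ := exists_isUpwindFamily hu hv hw₀ hB
  obtain ⟨C, -, hC⟩ := hρ₀.exists_torusL1_le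
  obtain ⟨M, hM⟩ := hX.exists_abs_mollified_and_partial_le hφ hα
  have hN : 0 ≤ (pressureExponent P Q : ℝ) * α := by positivity
  have hρ : ∀ ε ∈ Ioo (0 : ℝ) 1, ∀ t : ℝ, ContDiff ℝ ∞ (mollified φ α X ε t) :=
    fun ε hε t => contDiff_mollified hφ α X hε.1 t
  exact ⟨X, w,
    fun ε hε => ⟨hX.isUniqueUpwindSolution hε, hw.isUniqueUpwindSolution hε,
      fun t ht => ⟨hX.isTorusPeriodic hε ht, hw.isTorusPeriodic hε ht⟩⟩,
    ⟨C, fun ε hε t ht => ⟨hX.torusL1_le_torusL1_initial hε ht, hC ε hε⟩⟩,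
    ⟨M, fun ε hε t ht => ⟨hρ ε hε t, hM ε hε t ht⟩⟩,
    hw.exists_torusL1_le_one_add_div_rpow hN,
    hX.isWeakAsymptoticMethod_mollified hφ hβα,
    hX.attainsInitialData_mollified hφ.continuous hφ.2 hφ₁ hα,
    fun hN₁ => hw.isWeakAsymptoticMethod_pressureSource
      (fun ε hε t _ => (hρ ε hε t).of_le (mod_cast le_top)) hN hN₁,
    hw.attainsInitialData⟩

theorem mainTheorem6 (P Q : Polynomial ℝ) :
    ∃ N : ℕ, ∀ (α β : ℝ), 0 < α → α ≤ 1 → 0 < β → β < α →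
      ∀ φ : ℝ × ℝ → ℝ, IsTestFunction φ → (∫ p, φ p) = 1 →
      ∀ u v : ℝ → ℝ → (ℝ × ℝ →ᵇ ℝ), IsVelocityFamily β u → IsVelocityFamily β v →
      ∀ ρ₀ w₀ : ℝ → (ℝ × ℝ →ᵇ ℝ), IsInitialFamily ρ₀ → IsInitialFamily w₀ →
      ∃ X w : ℝ → ℝ → (ℝ × ℝ →ᵇ ℝ),
        -- the two ODEs have unique global solutions, which are periodic
        (∀ ε ∈ Set.Ioo (0 : ℝ) 1,
          IsUniqueUpwindSolution ε (u ε) (v ε) (fun _ _ => 0) (ρ₀ ε) (X ε) ∧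
          IsUniqueUpwindSolution ε (u ε) (v ε)
            (pressureSource P Q (mollified φ α X ε)) (w₀ ε) (w ε) ∧
          ∀ t : ℝ, 0 ≤ t → IsTorusPeriodic (X ε t) ∧ IsTorusPeriodic (w ε t)) ∧
        -- the `L¹` bound for `X`
        (∃ C : ℝ, ∀ ε ∈ Set.Ioo (0 : ℝ) 1, ∀ t : ℝ, 0 ≤ t →
          torusL1 (X ε t) ≤ torusL1 (ρ₀ ε) ∧ torusL1 (ρ₀ ε) ≤ C) ∧
        -- the pointwise bounds for `ρ` and its first derivatives
        (∃ M : ℝ, ∀ ε ∈ Set.Ioo (0 : ℝ) 1, ∀ t : ℝ, 0 ≤ t →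
          ContDiff ℝ ∞ (mollified φ α X ε t) ∧ ∀ p : ℝ × ℝ,
            |mollified φ α X ε t p| ≤ M / ε ^ (2 * α) ∧
            |partialX (mollified φ α X ε t) p| ≤ M / ε ^ (3 * α) ∧
            |partialY (mollified φ α X ε t) p| ≤ M / ε ^ (3 * α)) ∧
        -- the `L¹` bound for `w`
        (∃ C : ℝ, 0 < C ∧ ∀ ε ∈ Set.Ioo (0 : ℝ) 1, ∀ t : ℝ, 0 ≤ t →
          torusL1 (w ε t) ≤ C * (1 + t) / ε ^ ((N : ℝ) * α)) ∧
        -- the continuity equation for `ρ`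
        IsWeakAsymptoticMethod (mollified φ α X)
          (fun ε t p => u ε t p * mollified φ α X ε t p)
          (fun ε t p => v ε t p * mollified φ α X ε t p) ∧
        AttainsInitialData ρ₀ (mollified φ α X) ∧
        -- the equation for `w`
        ((N : ℝ) * α < 1 →
          IsWeakAsymptoticMethod (fun ε t p => w ε t p)
            (fun ε t p => u ε t p * w ε t p + P.eval (mollified φ α X ε t p))
            (fun ε t p => v ε t p * w ε t p + Q.eval (mollified φ α X ε t p))) ∧
        AttainsInitialData w₀ (fun ε t p => w ε t p) :=
  ⟨pressureExponent P Q, fun _ _ hα _ _ hβα _ hφ hφ₁ _ _ hu hv _ _ hρ₀ hw₀ =>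
    mainTheorem6_general P Q hα hβα hφ hφ₁ hu hv hρ₀ hw₀⟩
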